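/- Let $q$ be an indeterminate. For $r\ge 0$ let $[r]=(1-q^r)/(1-q)$, for $x,t\in\mathbb{Q}(q)$ and an integer $k\ge 0$ let $(x;t)_k=\prod_{i=0}^{k-1}(1-xt^i)$ (so $(x;t)_0=1$), and let $\Phi_n(q)$ be the $n$-th cyclotomic polynomial. Two rational functions in $q$ are called congruent modulo a nonzero polynomial $P(q)$ if $P(q)$ divides, in $\mathbb{Q}[q]$, the numerator of their difference written in lowest terms. Let $n$ be a positive integer and let $M=(n-1)/2$ or $M=n-1$. If $n\equiv 1\pmod 4$, then $$\sum_{k=0}^{M}(-1)^k[4k+1]\frac{(q;q^2)_k^4\,(q^2;q^4)_k}{(q^2;q^2)_k^4\,(q^4;q^4)_k}\,q^k\equiv [n]\,\frac{(q^2;q^4)_{(n-1)/4}^2}{(q^4;q^4)_{(n-1)/4}^2}\bigg\{1+[n]^2\sum_{j=1}^{(n-1)/2}\frac{(-1)^{j+1}q^{2j-n}}{[2j]^2}\bigg\}\pmod{[n]\Phi_n(q)^4}.$$ If $n\equiv 3\pmod 4$, then $$\sum_{k=0}^{M}(-1)^k[4k+1]\frac{(q;q^2)_k^4\,(q^2;q^4)_k}{(q^2;q^2)_k^4\,(q^4;q^4)_k}\,q^k\equiv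 [n]^2q^{(1-n)/2}\,\frac{(q^3;q^4)_{(n-1)/2}}{(q^5;q^4)_{(n-1)/2}}\pmod{[n]\Phi_n(q)^4}.$$ -/

import Mathlib

open Polynomial

noncomputable section

namespace QSuper

/-- The indeterminate `q`, as an element of the field `ℚ(q)` of rational functions. -/
def q : RatFunc ℚ := RatFunc.X

/-- The `q`-integer `[r] = (1 - q^r) / (1 - q)`. -/
def qInt (r : ℕ) : RatFunc ℚ := (1 - q ^ r) / (1 - q)

/-- The `q`-shifted factorial `(x; t)_k = (1 - x) (1 - x t) ⋯ (1 - x t^(k-1))`. -/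
def qPoch (x t : RatFunc ℚ) (k : ℕ) : RatFunc ℚ := ∏ i ∈ Finset.range k, (1 - x * t ^ i)

/-- The `q`-integer `[n]` as the polynomial `1 + q + ⋯ + q^(n-1)`. -/
def qIntPoly (n : ℕ) : ℚ[X] := ∑ i ∈ Finset.range n, X ^ i

theorem algebraMap_qIntPoly (n : ℕ) : algebraMap ℚ[X] (RatFunc ℚ) (qIntPoly n) = qInt n := by
  have h : (1 : RatFunc ℚ) - q ≠ 0 := by
    have h1 : (1 : ℚ[X]) - X ≠ 0 := by
      intro h
      have := congrArg (Polynomial.eval 0) h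
      simp at this
    have h2 := (map_ne_zero_iff (algebraMap ℚ[X] (RatFunc ℚ))
      (RatFunc.algebraMap_injective ℚ)).2 h1
    simpa [q] using h2
  rw [qInt, eq_div_iff h, qIntPoly, map_sum, ← geom_sum_mul_neg]
  simp [q]

/-- Two rational functions are congruent modulo the polynomial `P` if `P` divides the numerator
of their difference written in lowest terms. -/
def CongrMod (P : ℚ[X]) (f g : RatFunc ℚ) : Prop := P ∣ (f - g).num

/-- The truncated sum
`∑_{k=0}^M (-1)^k [4k+1] (q;q²)_k⁴ (q²;q⁴)_k / ((q²;q²)_k⁴ (q⁴;q⁴)_k) q^k`. -/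
def truncSum (M : ℕ) : RatFunc ℚ :=
  ∑ k ∈ Finset.range (M + 1),
    (-1) ^ k * qInt (4 * k + 1)
      * (qPoch q (q ^ 2) k ^ 4 * qPoch (q ^ 2) (q ^ 4) k)
      / (qPoch (q ^ 2) (q ^ 2) k ^ 4 * qPoch (q ^ 4) (q ^ 4) k) * q ^ k

end QSuper

end

/-! Write c_k for `poisedCoeff q k`, r_k for `oddEvenRatio q k` and u_k(w) for `poisedRatio q w k`;
then u_k(1) = r_k², and the summand is c_k u_k(1)². For n > 1 the modulus is Φ_n⁵ times the product
of the Φ_d with d ∣ n, 1 < d < n, and these factors are pairwise coprime. So it suffices to bound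
the order of vanishing of the difference at one primitive d-th root of unity ζ for each divisor d >
1.

At d = n = 2m+1 put w = q^n and use u_k(1)² = 2 u_k(1) u_k(w) - u_k(w)² + (u_k(w) - u_k(1))². The
sums of c_k u_k(w) u_k(y) over k ≤ m have a closed form, obtained by creative telescoping
(`poisedSum_even`, `poisedSum_odd`); taking y = 1 and y = w in the first two terms produces the
right-hand sides. For the square, u_k(w)/u_k(1) depends on w only through δ = (1-w)²/w and expands
as 1 + δ L_k + O(δ²). Hence the square contributes δ² times a sum that reduces at ζ to that of c_k
r_k⁴ L_k². The factor δ² accounts for Φ_n⁴. The remaining sum is zero at ζ because k ↦ m - k negates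
c_k r_k⁴ (`poisedTerm_reflect`) and fixes L_k (`logDerivSum_reflect`), which gives the fifth factor.
Each term with m < k < n already vanishes to order five.

At a proper divisor d only simple vanishing is needed. The sum splits into blocks of length d,
followed by a half block when M = (n-1)/2; at ζ each is a multiple of the initial one, which is zero
by the same antisymmetry. The right-hand sides vanish because of their factors [n]. -/

namespace QSuper

/-! ### Closed forms for the well-poised sum by creative telescoping. -/

section ExactSummation

variable {K : Type*} [Field K]

/-- The well-poised quotient `(qw, q/w; q²)_k / (q²w, q²/w; q²)_k`. -/
def poisedRatio (q w : K) (k : ℕ) : K :=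
  ∏ i ∈ Finset.range k, (1 - q ^ (2 * i + 1) * w) * (w - q ^ (2 * i + 1))
    / ((1 - q ^ (2 * i + 2) * w) * (w - q ^ (2 * i + 2)))

/-- The signed quotient `(-q)^k (q²; q⁴)_k / (q⁴; q⁴)_k`. -/
def signedRatio (q : K) (k : ℕ) : K :=
  ∏ i ∈ Finset.range k, (-q) * (1 - q ^ (4 * i + 2)) / (1 - q ^ (4 * i + 4))

/-- The coefficient `(-q)^k [4k+1] (q²; q⁴)_k / (q⁴; q⁴)_k`. -/
def poisedCoeff (q : K) (k : ℕ) : K := (1 - q ^ (4 * k + 1)) / (1 - q) * signedRatio q k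

/-- The common part of `poisedRatio q w` and `poisedRatio q (w * q ^ 4)`. -/
def shiftCore (q w : K) (k : ℕ) : K :=
  ∏ i ∈ Finset.range k, (1 - q ^ (2 * i + 1) * w) * (w * q ^ 3 - q ^ (2 * i))
    / ((1 - q ^ (2 * i + 2) * w) * (q * (w * q ^ 2 - q ^ (2 * i))))

/-- `shiftCore` takes its first factors from u_k(w) and its second ones from u_k(wq⁴). Shifting an
argument by q⁴ moves a product over i < k by two places, so each of the two ratios differs from it
by a rational function of q^(2k). -/
theorem poisedRatio_mul_eq_shiftCore {q w : K} (hq : q ≠ 0)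
    (h1 : ∀ i : ℕ, w * q ^ 2 - q ^ (2 * i) ≠ 0) (h2 : ∀ i : ℕ, 1 - q ^ (2 * i + 2) * w ≠ 0)
    (k : ℕ) :
    poisedRatio q w k
        * ((w * q ^ 3 - 1) * (w * q - 1) * (w * q ^ 2 - q ^ (2 * k)) * (w - q ^ (2 * k)))
      = shiftCore q w k
        * ((w * q ^ 3 - q ^ (2 * k)) * (w * q - q ^ (2 * k)) * (w * q ^ 2 - 1) * (w - 1)) := by
  induction k with
  | zero => simp [poisedRatio, shiftCore]
  | succ k ih =>
    rw [poisedRatio, shiftCore, Finset.prod_range_succ, Finset.prod_range_succ]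
    rw [← poisedRatio, ← shiftCore]
    have e1 : q ^ (2 * k + 1) = q * q ^ (2 * k) := by ring
    have e2 : q ^ (2 * k + 2) = q ^ 2 * q ^ (2 * k) := by ring
    have e3 : q ^ (2 * (k + 1)) = q ^ 2 * q ^ (2 * k) := by ring
    have h3 := h1 k
    have h4 := h2 k
    have h5 : w - q ^ (2 * k + 2) ≠ 0 := by
      have := h1 (k + 2)
      intro h
      apply this
      have e : q ^ (2 * (k + 2)) = q ^ (2 * k + 2) * q ^ 2 := by ring
      rw [e, ← sub_mul, h, zero_mul]
    rw [e2] at h4 h5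
    rw [e1, e2, e3]
    generalize q ^ (2 * k) = z at *
    generalize poisedRatio q w k = P at *
    generalize shiftCore q w k = S at *
    rw [mul_div_assoc', mul_div_assoc', div_mul_eq_mul_div, div_mul_eq_mul_div, div_eq_div_iff
      (mul_ne_zero h4 h5) (mul_ne_zero h4 (mul_ne_zero hq h3))]
    linear_combination ((1 - q * z * w) * (w - q * z) * (w - q ^ 2 * z) * q ^ 3
      * (1 - q ^ 2 * z * w)) * ih

theorem poisedRatio_shift_mul_eq_shiftCore {q w : K} (hq : q ≠ 0)
    (h1 : ∀ i : ℕ, w * q ^ 2 - q ^ (2 * i) ≠ 0) (h2 : ∀ i : ℕ, 1 - q ^ (2 * i + 2) * w ≠ 0)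
    (k : ℕ) :
    poisedRatio q (w * q ^ 4) k
        * ((1 - q * w) * (1 - q ^ 3 * w) * (1 - q ^ (2 * k) * q ^ 2 * w)
          * (1 - q ^ (2 * k) * q ^ 4 * w))
      = shiftCore q w k
        * ((1 - q ^ (2 * k) * q * w) * (1 - q ^ (2 * k) * q ^ 3 * w)
          * (1 - q ^ 2 * w) * (1 - q ^ 4 * w)) := by
  induction k with
  | zero => simp [poisedRatio, shiftCore]
  | succ k ih =>
    rw [poisedRatio, shiftCore, Finset.prod_range_succ, Finset.prod_range_succ]
    rw [← poisedRatio, ← shiftCore]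
    have e1 : q ^ (2 * k + 1) = q * q ^ (2 * k) := by ring
    have e2 : q ^ (2 * k + 2) = q ^ 2 * q ^ (2 * k) := by ring
    have e3 : q ^ (2 * (k + 1)) = q ^ 2 * q ^ (2 * k) := by ring
    have h3 := h1 k
    have h4 := h2 k
    have h5 : 1 - q ^ (2 * k + 2) * (w * q ^ 4) ≠ 0 := by
      have := h2 (k + 2)
      convert this using 2
      ring
    have h6 : w * q ^ 4 - q ^ (2 * k + 2) ≠ 0 := by
      have : w * q ^ 4 - q ^ (2 * k + 2) = q ^ 2 * (w * q ^ 2 - q ^ (2 * k)) := by ring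
      rw [this]
      exact mul_ne_zero (pow_ne_zero _ hq) h3
    rw [e2] at h4 h5 h6
    rw [e1, e2, e3]
    generalize q ^ (2 * k) = z at *
    generalize poisedRatio q (w * q ^ 4) k = P at *
    generalize shiftCore q w k = S at *
    rw [mul_div_assoc', mul_div_assoc', div_mul_eq_mul_div, div_mul_eq_mul_div, div_eq_div_iff
      (mul_ne_zero h5 h6) (mul_ne_zero h4 (mul_ne_zero hq h3))]
    linear_combination ((1 - q * z * (w * q ^ 4)) * (w * q ^ 4 - q * z) * q
      * (1 - q ^ 6 * z * w) * (w * q ^ 2 - z)) * ih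

/-- The telescoping antidifference of the shifted sum. -/
def antidiff (q w y : K) (k : ℕ) : K :=
  -(w * q ^ 2 * (1 - q ^ 4 * w ^ 2)) * signedRatio q k * shiftCore q w k * poisedRatio q y k
    * ((1 - q ^ (2 * k) * y) * (y - q ^ (2 * k)) * (1 - q ^ (4 * k)))
    / ((1 - q ^ (2 * k) * q ^ 2 * w) * (w * q ^ 2 - q ^ (2 * k)))

/-- A Zeilberger-type certificate for the shift w ↦ wq⁴: after division by the common factor
`signedRatio` · `shiftCore` · `poisedRatio q y`, both sides are rational in z = q^(2k), and the
claim is a polynomial identity. -/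
theorem telescoping_step {q w y : K} (hq : q ≠ 0) (hq1 : 1 - q ≠ 0)
    (h1 : ∀ i : ℕ, w * q ^ 2 - q ^ (2 * i) ≠ 0) (h2 : ∀ i : ℕ, 1 - q ^ (2 * i + 2) * w ≠ 0)
    (hy1 : ∀ i : ℕ, y - q ^ (2 * i + 2) ≠ 0) (hy2 : ∀ i : ℕ, 1 - q ^ (2 * i + 2) * y ≠ 0)
    (h4 : ∀ i : ℕ, 1 - q ^ (4 * i + 4) ≠ 0)
    (hw1 : 1 - q * w ≠ 0) (hw3 : 1 - q ^ 3 * w ≠ 0)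
    (k : ℕ) :
    poisedCoeff q k * poisedRatio q y k *
      ((1 - w) * (1 - q ^ 3 * w * y) * (y - q ^ 3 * w) * poisedRatio q (w * q ^ 4) k
        - (1 - q ^ 4 * w) * (1 - q * w * y) * (y - q * w) * poisedRatio q w k)
      = (1 - w) * (1 - q ^ 2 * w) * (1 - q ^ 4 * w) / ((1 - q * w) * (1 - q ^ 3 * w))
        * (antidiff q w y (k + 1) - antidiff q w y k) := by
  have L1 := poisedRatio_mul_eq_shiftCore hq h1 h2 k
  have L2 := poisedRatio_shift_mul_eq_shiftCore hq h1 h2 k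
  have a1 := h1 k
  have a2 := h2 k
  have a3 : w * q ^ 2 - q ^ 2 * q ^ (2 * k) ≠ 0 := by
    have := h1 (k + 1)
    convert this using 2
    ring
  have a4 := h2 (k + 1)
  have b1 := hy1 k
  have b2 := hy2 k
  have b3 := h4 k
  have a5 : w - q ^ (2 * k) ≠ 0 := by
    intro h
    apply a3
    linear_combination q ^ 2 * h
  have e0 : q ^ (4 * k + 1) = q * (q ^ (2 * k)) ^ 2 := by ring
  have e1 : q ^ (2 * k + 1) = q * q ^ (2 * k) := by ring
  have e2 : q ^ (2 * k + 2) = q ^ 2 * q ^ (2 * k) := by ring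
  have e3 : q ^ (2 * (k + 1)) = q ^ 2 * q ^ (2 * k) := by ring
  have e4 : q ^ (2 * (k + 1) + 2) = q ^ 4 * q ^ (2 * k) := by ring
  have e5 : q ^ (4 * k + 2) = q ^ 2 * (q ^ (2 * k)) ^ 2 := by ring
  have e6 : q ^ (4 * k + 4) = q ^ 4 * (q ^ (2 * k)) ^ 2 := by ring
  have e7 : q ^ (4 * (k + 1)) = q ^ 4 * (q ^ (2 * k)) ^ 2 := by ring
  have e8 : q ^ (4 * k) = (q ^ (2 * k)) ^ 2 := by ring
  have s1 : signedRatio q (k + 1)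
      = signedRatio q k * ((-q) * (1 - q ^ (4 * k + 2)) / (1 - q ^ (4 * k + 4))) :=
    Finset.prod_range_succ _ _
  have s2 : shiftCore q w (k + 1) = shiftCore q w k
      * ((1 - q ^ (2 * k + 1) * w) * (w * q ^ 3 - q ^ (2 * k))
        / ((1 - q ^ (2 * k + 2) * w) * (q * (w * q ^ 2 - q ^ (2 * k))))) :=
    Finset.prod_range_succ _ _
  have s3 : poisedRatio q y (k + 1) = poisedRatio q y k
      * ((1 - q ^ (2 * k + 1) * y) * (y - q ^ (2 * k + 1))
        / ((1 - q ^ (2 * k + 2) * y) * (y - q ^ (2 * k + 2)))) :=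
    Finset.prod_range_succ _ _
  rw [antidiff, antidiff, poisedCoeff, s1, s2, s3]
  rw [e2] at a2 b1 b2
  rw [e4] at a4
  rw [e6] at b3
  rw [e0, e1, e2, e3, e5, e6, e7, e8]
  generalize q ^ (2 * k) = z at *
  generalize poisedRatio q (w * q ^ 4) k = P' at *
  generalize poisedRatio q w k = P at *
  generalize poisedRatio q y k = Y at *
  generalize shiftCore q w k = S at *
  generalize signedRatio q k = R at *
  have hP' : P' = S * ((1 - z * q * w) * (1 - z * q ^ 3 * w)
          * (1 - q ^ 2 * w) * (1 - q ^ 4 * w)) / ((1 - q * w) * (1 - q ^ 3 * w)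
          * (1 - q ^ 2 * z * w) * (1 - q ^ 4 * z * w)) := by
    rw [eq_div_iff (by simp only [ne_eq, mul_eq_zero, not_or]; exact ⟨⟨⟨hw1, hw3⟩, a2⟩, a4⟩)]
    linear_combination L2
  have hP : P = S * ((w * q ^ 3 - z) * (w * q - z) * (1 - q ^ 2 * w) * (1 - w))
      / ((1 - q * w) * (1 - q ^ 3 * w) * (w * q ^ 2 - z) * (w - z)) := by
    rw [eq_div_iff (by simp only [ne_eq, mul_eq_zero, not_or]; exact ⟨⟨⟨hw1, hw3⟩, a1⟩, a5⟩)]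
    linear_combination L1
  have hz3 : w * q ^ 2 - q ^ 2 * z = q ^ 2 * (w - z) := by ring
  rw [hP', hP, hz3]
  -- The certificate cleared of denominators; the rest is bookkeeping of the common factors.
  have key : (1 - q * z ^ 2) * ((1 - q ^ 3 * w * y) * (y - q ^ 3 * w)
        * (1 - q * z * w) * (1 - q ^ 3 * z * w) * (w * q ^ 2 - z) * (w - z)
      - (1 - q * w * y) * (y - q * w) * (w * q ^ 3 - z) * (w * q - z)
        * (1 - q ^ 2 * z * w) * (1 - q ^ 4 * z * w))
      = w * (1 - q) * (1 - q ^ 4 * w ^ 2) *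
        ((1 - q ^ 2 * z ^ 2) * (1 - q * z * w) * (w * q ^ 3 - z) * (1 - q * z * y) * (y - q * z)
          + q ^ 2 * (1 - z * y) * (y - z) * (1 - z ^ 2) * (1 - q ^ 4 * z * w) * (w - z)) := by
    ring
  have lhs : (1 - q * z ^ 2) / (1 - q) * R * Y *
      ((1 - w) * (1 - q ^ 3 * w * y) * (y - q ^ 3 * w) *
          (S * ((1 - z * q * w) * (1 - z * q ^ 3 * w) * (1 - q ^ 2 * w) * (1 - q ^ 4 * w)) /
            ((1 - q * w) * (1 - q ^ 3 * w) * (1 - q ^ 2 * z * w) * (1 - q ^ 4 * z * w))) -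
        (1 - q ^ 4 * w) * (1 - q * w * y) * (y - q * w) *
          (S * ((w * q ^ 3 - z) * (w * q - z) * (1 - q ^ 2 * w) * (1 - w)) /
            ((1 - q * w) * (1 - q ^ 3 * w) * (w * q ^ 2 - z) * (w - z))))
      = ((1 - w) * (1 - q ^ 2 * w) * (1 - q ^ 4 * w) / ((1 - q * w) * (1 - q ^ 3 * w)))
        * (R * Y * S / ((1 - q) * ((1 - q ^ 2 * z * w) * (1 - q ^ 4 * z * w)
          * (w * q ^ 2 - z) * (w - z)))) *
        ((1 - q * z ^ 2) * ((1 - q ^ 3 * w * y) * (y - q ^ 3 * w)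
        * (1 - q * z * w) * (1 - q ^ 3 * z * w) * (w * q ^ 2 - z) * (w - z)
      - (1 - q * w * y) * (y - q * w) * (w * q ^ 3 - z) * (w * q - z)
        * (1 - q ^ 2 * z * w) * (1 - q ^ 4 * z * w))) := by
    generalize hA : 1 - q ^ 2 * z * w = A at *
    generalize hB : 1 - q ^ 4 * z * w = B at *
    generalize hC : w * q ^ 2 - z = C at *
    generalize hD : w - z = D at *
    generalize hE : 1 - q * w = E at *
    generalize hF : 1 - q ^ 3 * w = F at *
    generalize hG : 1 - q = G at *
    field_simp
  rw [lhs, key, mul_assoc]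
  congr 1
  generalize hA : 1 - q ^ 2 * z * w = A at *
  have hB' : 1 - q ^ 2 * z * q ^ 2 * w = 1 - q ^ 4 * z * w := by ring
  have hA' : 1 - z * q ^ 2 * w = A := by rw [← hA]; ring
  rw [hB', hA']
  generalize hB : 1 - q ^ 4 * z * w = B at *
  generalize hC : w * q ^ 2 - z = C at *
  generalize hD : w - z = D at *
  generalize hG : 1 - q = G at *
  generalize hH : 1 - q ^ 2 * z * y = H at *
  generalize hI : y - q ^ 2 * z = I at *
  generalize hJ : 1 - q ^ 4 * z ^ 2 = J at *
  field_simp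
  ring

theorem poisedRatio_eq_zero {q : K} {m k : ℕ} (h : m < k) :
    poisedRatio q (q ^ (2 * m + 1)) k = 0 :=
  Finset.prod_eq_zero (Finset.mem_range.2 h) (by simp)

theorem shiftCore_eq_zero {q : K} {m k : ℕ} (h : m + 2 < k) :
    shiftCore q (q ^ (2 * m + 1)) k = 0 :=
  Finset.prod_eq_zero (Finset.mem_range.2 h) (by
    rw [show q ^ (2 * m + 1) * q ^ 3 - q ^ (2 * (m + 2)) = 0 by ring]
    simp)

/-- The well-poised sum `∑_{k ≤ m} c_k u_k(q^{2m+1}) u_k(y)`. -/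
def poisedSum (q y : K) (m : ℕ) : K :=
  ∑ k ∈ Finset.range (m + 1),
    poisedCoeff q k * poisedRatio q (q ^ (2 * m + 1)) k * poisedRatio q y k

variable {q y : K}

theorem one_sub_pow_ne (hq : ∀ i : ℕ, 0 < i → q ^ i ≠ 1) {i : ℕ} (hi : 0 < i) :
    1 - q ^ i ≠ 0 :=
  fun h => hq i hi (sub_eq_zero.1 h).symm

theorem pow_sub_pow_ne (h0 : q ≠ 0) (hq : ∀ i : ℕ, 0 < i → q ^ i ≠ 1) {i j : ℕ} (hij : i ≠ j) :
    q ^ i - q ^ j ≠ 0 := by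
  rcases lt_or_gt_of_ne hij with h | h
  · obtain ⟨c, rfl⟩ := Nat.exists_eq_add_of_lt h
    rw [show q ^ i - q ^ (i + c + 1) = q ^ i * (1 - q ^ (c + 1)) by ring]
    exact mul_ne_zero (pow_ne_zero _ h0) (one_sub_pow_ne hq (by omega))
  · obtain ⟨c, rfl⟩ := Nat.exists_eq_add_of_lt h
    rw [show q ^ (j + c + 1) - q ^ j = -(q ^ j * (1 - q ^ (c + 1))) by ring]
    exact neg_ne_zero.2 (mul_ne_zero (pow_ne_zero _ h0) (one_sub_pow_ne hq (by omega)))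

/-- At w = q^(2m+1) the shift w ↦ wq⁴ is m ↦ m+2, so the recurrence respects the parity of m. This
is the source of the two cases of n modulo 4. -/
theorem poisedSum_recurrence (h0 : q ≠ 0) (hq : ∀ i : ℕ, 0 < i → q ^ i ≠ 1)
    (hy1 : ∀ i : ℕ, y - q ^ (2 * i + 2) ≠ 0) (hy2 : ∀ i : ℕ, 1 - q ^ (2 * i + 2) * y ≠ 0)
    (m : ℕ) :
    (1 - q ^ (2 * m + 1)) * (1 - q ^ (2 * m + 4) * y) * (y - q ^ (2 * m + 4))
        * poisedSum q y (m + 2)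
      = (1 - q ^ (2 * m + 5)) * (1 - q ^ (2 * m + 2) * y) * (y - q ^ (2 * m + 2))
        * poisedSum q y m := by
  set w := q ^ (2 * m + 1) with hw
  have step := fun k => telescoping_step (q := q) (w := w) (y := y) h0
    (by simpa using one_sub_pow_ne hq one_pos)
    (fun i => by rw [hw, ← pow_add]; exact pow_sub_pow_ne h0 hq (by omega))
    (fun i => by rw [hw, ← pow_add]; exact one_sub_pow_ne hq (by omega)) hy1 hy2
    (fun i => one_sub_pow_ne hq (by omega))
    (by rw [hw, ← pow_succ']; exact one_sub_pow_ne hq (by omega))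
    (by rw [hw, ← pow_add]; exact one_sub_pow_ne hq (by omega)) k
  have tel := Finset.sum_congr (rfl : Finset.range (m + 3) = _) (fun k _ => step k)
  rw [← Finset.mul_sum, Finset.sum_range_sub (antidiff q w y)] at tel
  -- Both boundary terms vanish: at 0 by the factor 1 - q^(4k), at m+3 because wq³ = q^(2(m+2))
  -- kills `shiftCore`.
  have g0 : antidiff q w y 0 = 0 := by simp [antidiff]
  have g1 : antidiff q w y (m + 3) = 0 := by
    rw [antidiff, hw, shiftCore_eq_zero (by omega)]
    simp
  rw [g0, g1, sub_zero, mul_zero] at tel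
  -- The two extra terms contain the factor w - q^(2m+1) = 0.
  have hm : poisedSum q y m = ∑ k ∈ Finset.range (m + 3),
      poisedCoeff q k * poisedRatio q w k * poisedRatio q y k := by
    rw [Finset.sum_range_succ, Finset.sum_range_succ, poisedRatio_eq_zero (by omega),
      poisedRatio_eq_zero (by omega), poisedSum]
    simp [hw]
  have hm2 : poisedSum q y (m + 2) = ∑ k ∈ Finset.range (m + 3),
      poisedCoeff q k * poisedRatio q (w * q ^ 4) k * poisedRatio q y k := by
    rw [poisedSum, hw, ← pow_add, show 2 * (m + 2) + 1 = 2 * m + 1 + 4 by ring]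
  have e4 : q ^ (2 * m + 4) = q ^ 3 * w := by rw [hw]; ring
  have e5 : q ^ (2 * m + 5) = q ^ 4 * w := by rw [hw]; ring
  have e2 : q ^ (2 * m + 2) = q * w := by rw [hw]; ring
  rw [e4, e5, e2, hm, hm2, Finset.mul_sum, Finset.mul_sum, ← sub_eq_zero,
    ← Finset.sum_sub_distrib, ← tel]
  exact Finset.sum_congr rfl fun k _ => by ring

theorem poisedSum_zero (hq1 : 1 - q ≠ 0) : poisedSum q y 0 = 1 := by
  simp [poisedSum, poisedCoeff, poisedRatio, signedRatio, hq1]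

theorem poisedSum_even (h0 : q ≠ 0) (hq : ∀ i : ℕ, 0 < i → q ^ i ≠ 1)
    (hy1 : ∀ i : ℕ, y - q ^ (2 * i + 2) ≠ 0) (hy2 : ∀ i : ℕ, 1 - q ^ (2 * i + 2) * y ≠ 0)
    (j : ℕ) :
    poisedSum q y (2 * j) = (1 - q ^ (4 * j + 1)) / (1 - q) *
      ∏ i ∈ Finset.range j, (1 - q ^ (4 * i + 2) * y) * (y - q ^ (4 * i + 2))
        / ((1 - q ^ (4 * i + 4) * y) * (y - q ^ (4 * i + 4))) := by
  have hq1 : 1 - q ≠ 0 := by simpa using one_sub_pow_ne hq one_pos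
  induction j with
  | zero => simp [poisedSum_zero hq1, hq1]
  | succ j ih =>
    have h := poisedSum_recurrence h0 hq hy1 hy2 (2 * j)
    rw [ih] at h
    rw [Finset.prod_range_succ]
    have a1 : 1 - q ^ (4 * j + 1) ≠ 0 := one_sub_pow_ne hq (by omega)
    have a2 : 1 - q ^ (4 * j + 4) * y ≠ 0 := by
      have := hy2 (2 * j + 1); rwa [show 2 * (2 * j + 1) + 2 = 4 * j + 4 by ring] at this
    have a3 : y - q ^ (4 * j + 4) ≠ 0 := by
      have := hy1 (2 * j + 1); rwa [show 2 * (2 * j + 1) + 2 = 4 * j + 4 by ring] at this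
    rw [show 2 * (2 * j) = 4 * j by ring] at h
    rw [show 2 * (j + 1) = 2 * j + 2 by ring, show 4 * (j + 1) + 1 = 4 * j + 5 by ring]
    refine mul_left_cancel₀ (mul_ne_zero (mul_ne_zero a1 a2) a3) (h.trans ?_)
    generalize (∏ i ∈ Finset.range j, (_ : K)) = T
    generalize 1 - q ^ (4 * j + 4) * y = A at *
    field_simp

theorem poisedSum_odd (h0 : q ≠ 0) (hq : ∀ i : ℕ, 0 < i → q ^ i ≠ 1)
    (hy1 : ∀ i : ℕ, y - q ^ (2 * i + 2) ≠ 0) (hy2 : ∀ i : ℕ, 1 - q ^ (2 * i + 2) * y ≠ 0)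
    (j : ℕ) :
    poisedSum q y (2 * j + 1) = (1 - q ^ (4 * j + 3)) / (1 - q) *
      (q * (1 - y) ^ 2 / ((1 - q ^ 2 * y) * (y - q ^ 2)) *
      ∏ i ∈ Finset.range j, (1 - q ^ (4 * i + 4) * y) * (y - q ^ (4 * i + 4))
        / ((1 - q ^ (4 * i + 6) * y) * (y - q ^ (4 * i + 6)))) := by
  have hq1 : 1 - q ≠ 0 := by simpa using one_sub_pow_ne hq one_pos
  induction j with
  | zero =>
    have b1 : 1 - q ^ 2 * y ≠ 0 := hy2 0
    have b2 : y - q ^ 2 ≠ 0 := hy1 0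
    have b3 : 1 - q ^ 4 ≠ 0 := one_sub_pow_ne hq (by omega)
    have b4 : 1 - q ^ 5 ≠ 0 := one_sub_pow_ne hq (by omega)
    have b5 : q ^ 3 - q ^ 2 ≠ 0 := pow_sub_pow_ne h0 hq (by omega)
    have hc : poisedCoeff q 1 * poisedRatio q (q ^ 3) 1 = -(1 + q) ^ 2 := by
      simp only [poisedCoeff, poisedRatio, signedRatio, Finset.prod_range_one]
      norm_num
      rw [← pow_succ', ← pow_add, div_mul_div_comm, div_mul_div_comm, div_eq_iff
        (mul_ne_zero (mul_ne_zero hq1 b3) (mul_ne_zero b4 b5))]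
      ring
    -- This two-term sum produces the factor (1-y)², which the recurrence then preserves; it makes
    -- the odd sums vanish at y = 1.
    have h2 : poisedSum q y 1 = 1 + -(1 + q) ^ 2 * poisedRatio q y 1 := by
      rw [poisedSum, Finset.sum_range_succ, ← hc]
      simp [poisedCoeff, poisedRatio, signedRatio, hq1]
    rw [mul_zero, zero_add, h2]
    simp only [poisedRatio, Finset.prod_range_one, Finset.prod_range_zero]
    norm_num
    generalize hA : 1 - q ^ 2 * y = A at *
    generalize hB : y - q ^ 2 = B at *
    generalize hC : 1 - q = C at *
    field_simp
    rw [← hA, ← hB, ← hC]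
    ring
  | succ j ih =>
    have h := poisedSum_recurrence h0 hq hy1 hy2 (2 * j + 1)
    rw [ih] at h
    rw [Finset.prod_range_succ]
    have a1 : 1 - q ^ (4 * j + 3) ≠ 0 := one_sub_pow_ne hq (by omega)
    have a2 : 1 - q ^ (4 * j + 6) * y ≠ 0 := by
      have := hy2 (2 * j + 2); rwa [show 2 * (2 * j + 2) + 2 = 4 * j + 6 by ring] at this
    have a3 : y - q ^ (4 * j + 6) ≠ 0 := by
      have := hy1 (2 * j + 2); rwa [show 2 * (2 * j + 2) + 2 = 4 * j + 6 by ring] at this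
    rw [show 2 * (2 * j + 1) + 1 = 4 * j + 3 by ring, show 2 * (2 * j + 1) + 4 = 4 * j + 6 by ring,
      show 2 * (2 * j + 1) + 5 = 4 * j + 7 by ring,
      show 2 * (2 * j + 1) + 2 = 4 * j + 4 by ring] at h
    rw [show 2 * (j + 1) + 1 = 2 * j + 1 + 2 by ring, show 4 * (j + 1) + 3 = 4 * j + 7 by ring]
    refine mul_left_cancel₀ (mul_ne_zero (mul_ne_zero a1 a2) a3) (h.trans ?_)
    generalize (∏ i ∈ Finset.range j, (_ : K)) = T
    generalize q * (1 - y) ^ 2 / _ = A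
    generalize 1 - q ^ (4 * j + 6) * y = B at *
    field_simp

end ExactSummation

/-! ### Reflection symmetry k ↦ h - k at a root of unity of order 2h+1. -/

section RootOfUnity

variable {K : Type*} [Field K]

/-- The quotient `(q; q²)_k / (q²; q²)_k`. -/
def oddEvenRatio (q : K) (k : ℕ) : K :=
  ∏ i ∈ Finset.range k, (1 - q ^ (2 * i + 1)) / (1 - q ^ (2 * i + 2))

/-- The term `(-q)^k [4k+1] (q²; q⁴)_k (q; q²)_k⁴ / ((q⁴; q⁴)_k (q²; q²)_k⁴)`. -/
def poisedTerm (q : K) (k : ℕ) : K := poisedCoeff q k * oddEvenRatio q k ^ 4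

/-- The function `q^j / (1 - q^j)²`. -/
def koebe (q : K) (j : ℕ) : K := q ^ j / (1 - q ^ j) ^ 2

/-- The logarithmic derivative `∑_{i<k} (q^{2i+2}/(1-q^{2i+2})² - q^{2i+1}/(1-q^{2i+1})²)`. -/
def logDerivSum (q : K) (k : ℕ) : K :=
  ∑ i ∈ Finset.range k, (koebe q (2 * i + 2) - koebe q (2 * i + 1))

theorem signedRatio_eq (q : K) (k : ℕ) :
    signedRatio q k = (-q) ^ k * oddEvenRatio (q ^ 2) k := by
  rw [signedRatio, oddEvenRatio, ← Finset.card_range k, ← Finset.prod_const, Finset.card_range,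
    ← Finset.prod_mul_distrib]
  refine Finset.prod_congr rfl fun i _ => ?_
  rw [← pow_mul, ← pow_mul, mul_div_assoc]
  ring_nf

theorem poisedRatio_one (q : K) (k : ℕ) : poisedRatio q 1 k = oddEvenRatio q k ^ 2 := by
  rw [poisedRatio, oddEvenRatio, ← Finset.prod_pow]
  exact Finset.prod_congr rfl fun i _ => by rw [mul_one, mul_one, div_pow, sq, sq]

variable {z : K} {h : ℕ}

theorem one_sub_pow_reflect (hz : z ^ (2 * h + 1) = 1) {i : ℕ} (hi : i < h) :
    1 - z ^ (2 * i + 1) = -z ^ (2 * i + 1) * (1 - z ^ (2 * (h - 1 - i) + 2)) := by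
  have : z ^ (2 * i + 1) * z ^ (2 * (h - 1 - i) + 2) = 1 := by
    rw [← pow_add, ← hz]
    congr 1
    omega
  linear_combination -this

/-- The product `(q²; q²)_k`. -/
def evenPoch (q : K) (k : ℕ) : K := ∏ i ∈ Finset.range k, (1 - q ^ (2 * i + 2))

theorem prod_odd_mul_evenPoch (hz : z ^ (2 * h + 1) = 1) {k : ℕ} (hk : k ≤ h) :
    (∏ i ∈ Finset.range k, (1 - z ^ (2 * i + 1))) * evenPoch z (h - k)
      = (-1) ^ k * z ^ (k ^ 2) * evenPoch z h := by
  induction k with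
  | zero => simp
  | succ k ih =>
    have e : evenPoch z (h - k)
        = evenPoch z (h - (k + 1)) * (1 - z ^ (2 * (h - 1 - k) + 2)) := by
      rw [show h - k = (h - (k + 1)) + 1 by omega, evenPoch, Finset.prod_range_succ, ← evenPoch,
        show h - (k + 1) = h - 1 - k by omega]
    rw [e] at ih
    rw [Finset.prod_range_succ, one_sub_pow_reflect hz (by omega)]
    have e2 : z ^ ((k + 1) ^ 2) = z ^ (k ^ 2) * z ^ (2 * k + 1) := by ring
    rw [e2, pow_succ (-1 : K)]
    linear_combination -z ^ (2 * k + 1) * ih (by omega)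

/-- Up to units the first k odd factors are the top k factors of (z²;z²)_h, so r_k becomes a signed
power of z times a Gaussian binomial in base z², which is symmetric under k ↦ h - k. -/
theorem oddEvenRatio_mul_evenPoch (hz : z ^ (2 * h + 1) = 1)
    (hz1 : ∀ i : ℕ, 0 < i → i < 2 * h + 1 → z ^ i ≠ 1) {k : ℕ} (hk : k ≤ h) :
    oddEvenRatio z k = (-1) ^ k * z ^ (k ^ 2)
      * (evenPoch z h / (evenPoch z k * evenPoch z (h - k))) := by
  have ne : ∀ j ≤ h, evenPoch z j ≠ 0 := fun j hj =>
    Finset.prod_ne_zero_iff.2 fun i hi => by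
      have := Finset.mem_range.1 hi
      exact fun h0 => hz1 _ (by omega) (by omega) (sub_eq_zero.1 h0).symm
  rw [oddEvenRatio, Finset.prod_div_distrib, ← evenPoch, mul_div_assoc',
    ← prod_odd_mul_evenPoch hz hk]
  have h1 := ne k hk
  have h2 := ne (h - k) (by omega)
  field_simp

theorem pow_reflect (hz : z ^ (2 * h + 1) = 1) {j k : ℕ} (hjk : j + k = h) :
    z ^ (6 * j ^ 2 + j) = z ^ (6 * k ^ 2 + 5 * k + 1) := by
  have h0 : z ≠ 0 := by
    rintro rfl
    simp at hz
  have : (6 * j ^ 2 + j : ℤ) = (6 * k ^ 2 + 5 * k + 1) + (2 * h + 1) * (3 * j - 3 * k - 1) := by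
    rw [← hjk]; push_cast; ring
  have hz' : z ^ (2 * h + 1 : ℤ) = 1 := by exact_mod_cast hz
  rw [← zpow_natCast, ← zpow_natCast]
  push_cast
  rw [this, zpow_add₀ h0, zpow_mul, hz', one_zpow, mul_one]

/-- Apart from symmetric Gaussian binomials, the term is z^(6k²+k) - z^(6k²+5k+1), and by
`pow_reflect` the reflection exchanges these two powers. The exponent 6k²+k collects k from (-z)^k,
4k² from r_k⁴ and 2k² from the base z² ratio. -/
theorem poisedTerm_reflect (hz : z ^ (2 * h + 1) = 1)
    (hz1 : ∀ i : ℕ, 0 < i → i < 2 * h + 1 → z ^ i ≠ 1) {k : ℕ} (hk : k ≤ h) :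
    poisedTerm z (h - k) = -poisedTerm z k := by
  have form : ∀ j ≤ h, poisedTerm z j = z ^ (6 * j ^ 2 + j) * (1 - z ^ (4 * j + 1)) *
      ((evenPoch z h / (evenPoch z j * evenPoch z (h - j))) ^ 4
        * (evenPoch (z ^ 2) h / (evenPoch (z ^ 2) j * evenPoch (z ^ 2) (h - j))) / (1 - z)) := by
    intro j hj
    have hz' : (z ^ 2) ^ (2 * h + 1) = 1 := by rw [← pow_mul, mul_comm, pow_mul, hz, one_pow]
    -- As the order 2h+1 is odd, z² is again primitive.
    have hz1' : ∀ i : ℕ, 0 < i → i < 2 * h + 1 → (z ^ 2) ^ i ≠ 1 := by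
      intro i hi hi2 h1
      rw [← pow_mul] at h1
      by_cases hc : 2 * i < 2 * h + 1
      · exact hz1 _ (by omega) hc h1
      · apply hz1 (2 * i - (2 * h + 1)) (by omega) (by omega)
        rw [show 2 * i = (2 * i - (2 * h + 1)) + (2 * h + 1) by omega, pow_add, hz, mul_one] at h1
        exact h1
    rw [poisedTerm, poisedCoeff, signedRatio_eq, oddEvenRatio_mul_evenPoch hz hz1 hj,
      oddEvenRatio_mul_evenPoch hz' hz1' hj]
    generalize evenPoch z h / _ = A
    generalize evenPoch (z ^ 2) h / _ = B
    rw [neg_pow z, mul_pow, mul_pow, ← pow_mul, ← pow_mul, ← pow_mul]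
    have s1 : ((-1 : K) ^ (j * 4)) = 1 := Even.neg_one_pow ⟨j * 2, by ring⟩
    have s2 : ((-1 : K) ^ j) * (-1) ^ j = 1 := by
      rw [← mul_pow]; simp
    rw [s1, pow_add, show 6 * j ^ 2 = 2 * j ^ 2 + j ^ 2 * 4 by ring, pow_add]
    linear_combination ((1 - z ^ (4 * j + 1)) / (1 - z) * z ^ j * z ^ (2 * j ^ 2) * B
      * z ^ (j ^ 2 * 4) * A ^ 4) * s2
  rw [form k hk, form (h - k) (by omega), show h - (h - k) = k by omega,
    mul_comm (evenPoch z (h - k)), mul_comm (evenPoch (z ^ 2) (h - k))]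
  have r1 := pow_reflect hz (show (h - k) + k = h by omega)
  have r2 := pow_reflect hz (show k + (h - k) = h by omega)
  generalize h - k = j at *
  rw [← neg_mul]
  congr 1
  have e1 : z ^ (6 * j ^ 2 + 5 * j + 1) = z ^ (6 * j ^ 2 + j) * z ^ (4 * j + 1) := by ring
  have e2 : z ^ (6 * k ^ 2 + 5 * k + 1) = z ^ (6 * k ^ 2 + k) * z ^ (4 * k + 1) := by ring
  rw [e1] at r2
  rw [e2] at r1
  linear_combination r1 + r2

/-- The function x/(1-x)² is invariant under x ↦ 1/x. -/
theorem koebe_reflect (hz : z ^ (2 * h + 1) = 1) {i : ℕ} (hi : i < h) :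
    koebe z (2 * i + 1) = koebe z (2 * (h - 1 - i) + 2) := by
  have h0 : z ≠ 0 := by
    rintro rfl
    simp at hz
  have e : z ^ (2 * i + 1) * z ^ (2 * (h - 1 - i) + 2) = 1 := by
    rw [← pow_add, ← hz]
    congr 1
    omega
  rw [koebe, koebe, one_sub_pow_reflect hz hi]
  have h1 : z ^ (2 * i + 1) ≠ 0 := pow_ne_zero _ h0
  rw [mul_pow, neg_sq, sq (z ^ (2 * i + 1)), mul_assoc, div_mul_eq_div_div, div_self h1,
    div_mul_eq_div_div, ← eq_one_div_of_mul_eq_one_right e]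

theorem logDerivSum_eq (hz : z ^ (2 * h + 1) = 1) {k : ℕ} (hk : k ≤ h) :
    logDerivSum z k + ∑ i ∈ Finset.range h, koebe z (2 * i + 2)
      = ∑ i ∈ Finset.range k, koebe z (2 * i + 2)
        + ∑ i ∈ Finset.range (h - k), koebe z (2 * i + 2) := by
  induction k with
  | zero => simp [logDerivSum]
  | succ k ih =>
    have ih := ih (by omega)
    rw [show h - k = (h - (k + 1)) + 1 by omega, Finset.sum_range_succ _ (h - (k + 1))] at ih
    rw [logDerivSum, Finset.sum_range_succ, Finset.sum_range_succ _ k, ← logDerivSum,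
      koebe_reflect hz (by omega), show h - 1 - k = h - (k + 1) by omega]
    linear_combination ih

theorem logDerivSum_reflect (hz : z ^ (2 * h + 1) = 1) {k : ℕ} (hk : k ≤ h) :
    logDerivSum z (h - k) = logDerivSum z k := by
  have h1 := logDerivSum_eq hz hk
  have h2 := logDerivSum_eq hz (k := h - k) (by omega)
  rw [show h - (h - k) = k by omega] at h2
  linear_combination h2 - h1

theorem sum_poisedTerm_mul_eq_zero [CharZero K] (hz : z ^ (2 * h + 1) = 1)
    (hz1 : ∀ i : ℕ, 0 < i → i < 2 * h + 1 → z ^ i ≠ 1) (g : ℕ → K)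
    (hg : ∀ k ≤ h, g (h - k) = g k) :
    ∑ k ∈ Finset.range (h + 1), poisedTerm z k * g k = 0 := by
  have e := Finset.sum_range_reflect (fun k => poisedTerm z k * g k) (h + 1)
  have e2 : ∑ j ∈ Finset.range (h + 1), poisedTerm z (h + 1 - 1 - j) * g (h + 1 - 1 - j)
      = -∑ k ∈ Finset.range (h + 1), poisedTerm z k * g k := by
    rw [← Finset.sum_neg_distrib]
    refine Finset.sum_congr rfl fun k hk => ?_
    have hk : k ≤ h := by have := Finset.mem_range.1 hk; omega
    rw [Nat.add_sub_cancel, poisedTerm_reflect hz hz1 hk, hg k hk, neg_mul]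
  rw [e2] at e
  exact self_eq_neg.1 e.symm

theorem poisedTerm_eq_zero (hz : z ^ (2 * h + 1) = 1) {k : ℕ} (hk : h < k) :
    poisedTerm z k = 0 := by
  rw [poisedTerm, oddEvenRatio, Finset.prod_eq_zero (Finset.mem_range.2 hk) (by simp [hz])]
  simp

end RootOfUnity

/-! ### Values of rational functions at a complex point, and divisibility by cyclotomic polynomials.
-/

section Values

/-- The rational function `f` is regular at `ζ`, where it takes the value `v`. -/
def HasVal (ζ : ℂ) (f : RatFunc ℚ) (v : ℂ) : Prop :=
  ∃ a b : ℚ[X], aeval ζ b ≠ 0 ∧ f * algebraMap ℚ[X] (RatFunc ℚ) b = algebraMap ℚ[X] (RatFunc ℚ) a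
    ∧ aeval ζ a = v * aeval ζ b

/-- The rational function `f` is regular at `ζ`. -/
def IsRegular (ζ : ℂ) (f : RatFunc ℚ) : Prop := ∃ v, HasVal ζ f v

variable {ζ : ℂ} {f g : RatFunc ℚ} {v w : ℂ}

theorem hasVal_algebraMap (p : ℚ[X]) : HasVal ζ (algebraMap ℚ[X] (RatFunc ℚ) p) (aeval ζ p) :=
  ⟨p, 1, by simp, by simp, by simp⟩

theorem hasVal_one : HasVal ζ 1 1 := by simpa using hasVal_algebraMap (ζ := ζ) 1

theorem hasVal_zero : HasVal ζ 0 0 := by simpa using hasVal_algebraMap (ζ := ζ) 0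

theorem hasVal_q : HasVal ζ q ζ := by simpa [q] using hasVal_algebraMap (ζ := ζ) X

theorem HasVal.add (hf : HasVal ζ f v) (hg : HasVal ζ g w) : HasVal ζ (f + g) (v + w) := by
  obtain ⟨a, b, hb, e, ea⟩ := hf
  obtain ⟨a', b', hb', e', ea'⟩ := hg
  refine ⟨a * b' + a' * b, b * b', by simp [hb, hb'], ?_, ?_⟩
  · rw [map_add, map_mul, map_mul, map_mul, ← e, ← e']; ring
  · rw [map_add, map_mul, map_mul, map_mul, ea, ea']; ring

theorem HasVal.mul (hf : HasVal ζ f v) (hg : HasVal ζ g w) : HasVal ζ (f * g) (v * w) := by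
  obtain ⟨a, b, hb, e, ea⟩ := hf
  obtain ⟨a', b', hb', e', ea'⟩ := hg
  refine ⟨a * a', b * b', by simp [hb, hb'], ?_, ?_⟩
  · rw [map_mul, map_mul, ← e, ← e']; ring
  · rw [map_mul, map_mul, ea, ea']; ring

theorem HasVal.neg (hf : HasVal ζ f v) : HasVal ζ (-f) (-v) := by
  obtain ⟨a, b, hb, e, ea⟩ := hf
  exact ⟨-a, b, hb, by rw [map_neg, ← e, neg_mul], by rw [map_neg, ea, neg_mul]⟩

theorem HasVal.sub (hf : HasVal ζ f v) (hg : HasVal ζ g w) : HasVal ζ (f - g) (v - w) := by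
  rw [sub_eq_add_neg, sub_eq_add_neg]
  exact hf.add hg.neg

theorem HasVal.pow (hf : HasVal ζ f v) (k : ℕ) : HasVal ζ (f ^ k) (v ^ k) := by
  induction k with
  | zero => simpa using hasVal_one
  | succ k ih => rw [pow_succ, pow_succ]; exact ih.mul hf

theorem HasVal.inv (hf : HasVal ζ f v) (hv : v ≠ 0) : HasVal ζ f⁻¹ v⁻¹ := by
  obtain ⟨a, b, hb, e, ea⟩ := hf
  have ha : aeval ζ a ≠ 0 := by rw [ea]; exact mul_ne_zero hv hb
  have ha0 : algebraMap ℚ[X] (RatFunc ℚ) a ≠ 0 := by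
    intro h
    have : a = 0 := RatFunc.algebraMap_injective ℚ (by simpa using h)
    exact ha (by simp [this])
  have hf0 : f ≠ 0 := by
    rintro rfl
    exact ha0 (by rw [← e, zero_mul])
  refine ⟨b, a, ha, ?_, ?_⟩
  · rw [← e, inv_mul_cancel_left₀ hf0]
  · rw [ea, inv_mul_cancel_left₀ hv]

theorem HasVal.div (hf : HasVal ζ f v) (hg : HasVal ζ g w) (hw : w ≠ 0) :
    HasVal ζ (f / g) (v / w) := by
  rw [div_eq_mul_inv, div_eq_mul_inv]
  exact hf.mul (hg.inv hw)

theorem HasVal.sum {ι : Type*} {s : Finset ι} {f : ι → RatFunc ℚ} {v : ι → ℂ}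
    (h : ∀ i ∈ s, HasVal ζ (f i) (v i)) : HasVal ζ (∑ i ∈ s, f i) (∑ i ∈ s, v i) := by
  classical
  induction s using Finset.induction_on with
  | empty => simpa using hasVal_zero
  | insert a s ha ih =>
    rw [Finset.sum_insert ha, Finset.sum_insert ha]
    exact (h a (by simp)).add (ih fun i hi => h i (by simp [hi]))

theorem HasVal.prod {ι : Type*} {s : Finset ι} {f : ι → RatFunc ℚ} {v : ι → ℂ}
    (h : ∀ i ∈ s, HasVal ζ (f i) (v i)) : HasVal ζ (∏ i ∈ s, f i) (∏ i ∈ s, v i) := by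
  classical
  induction s using Finset.induction_on with
  | empty => simpa using hasVal_one
  | insert a s ha ih =>
    rw [Finset.prod_insert ha, Finset.prod_insert ha]
    exact (h a (by simp)).mul (ih fun i hi => h i (by simp [hi]))

theorem hasVal_one_sub_pow (k : ℕ) : HasVal ζ (1 - q ^ k) (1 - ζ ^ k) :=
  hasVal_one.sub (hasVal_q.pow k)

theorem HasVal.isRegular (hf : HasVal ζ f v) : IsRegular ζ f := ⟨v, hf⟩

theorem IsRegular.add (hf : IsRegular ζ f) (hg : IsRegular ζ g) : IsRegular ζ (f + g) :=
  let ⟨_, h⟩ := hf; let ⟨_, h'⟩ := hg; ⟨_, h.add h'⟩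

theorem IsRegular.mul (hf : IsRegular ζ f) (hg : IsRegular ζ g) : IsRegular ζ (f * g) :=
  let ⟨_, h⟩ := hf; let ⟨_, h'⟩ := hg; ⟨_, h.mul h'⟩

theorem IsRegular.pow (hf : IsRegular ζ f) (k : ℕ) : IsRegular ζ (f ^ k) :=
  let ⟨_, h⟩ := hf; ⟨_, h.pow k⟩

theorem IsRegular.sum {ι : Type*} {s : Finset ι} {f : ι → RatFunc ℚ}
    (h : ∀ i ∈ s, IsRegular ζ (f i)) : IsRegular ζ (∑ i ∈ s, f i) := by
  classical
  induction s using Finset.induction_on with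
  | empty => simpa using hasVal_zero.isRegular
  | insert a s ha ih =>
    rw [Finset.sum_insert ha]
    exact (h a (by simp)).add (ih fun i hi => h i (by simp [hi]))

theorem HasVal.zero_mul_isRegular (hf : HasVal ζ f 0) (hg : IsRegular ζ g) :
    HasVal ζ (f * g) 0 := by
  obtain ⟨w, hg⟩ := hg
  simpa using hf.mul hg

/-- Each factor 1 - q^n supplies one Φ_n, and g supplies one more since Φ_n is the minimal
polynomial of ζ; the denominator of g is coprime to Φ_n. -/
theorem cyclotomic_pow_dvd_num {n e : ℕ} (hn : 0 < n) (hζ : IsPrimitiveRoot ζ n)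
    (hg : HasVal ζ g 0) (hf : f = (1 - q ^ n) ^ e * g) :
    cyclotomic n ℚ ^ (e + 1) ∣ f.num := by
  obtain ⟨a, b, hb, ee, ea⟩ := hg
  have hmin := cyclotomic_eq_minpoly_rat hζ hn
  have hirr : Irreducible (cyclotomic n ℚ) := cyclotomic.irreducible_rat hn
  obtain ⟨c, hc⟩ : cyclotomic n ℚ ∣ a := by
    rw [hmin]
    exact minpoly.dvd ℚ ζ (by rw [ea, zero_mul])
  have hcop : IsCoprime (cyclotomic n ℚ ^ (e + 1)) b := by
    refine IsCoprime.pow_left ((hirr.coprime_iff_not_dvd).2 ?_)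
    rintro ⟨r, rfl⟩
    apply hb
    rw [map_mul, hmin, minpoly.aeval, zero_mul]
  obtain ⟨s, hs⟩ : cyclotomic n ℚ ∣ 1 - X ^ n := by
    rw [← neg_sub]
    exact (dvd_neg).2 (cyclotomic.dvd_X_pow_sub_one n ℚ)
  have key : f.num * b = (1 - X ^ n) ^ e * a * f.denom := by
    apply RatFunc.algebraMap_injective ℚ
    have hd : algebraMap ℚ[X] (RatFunc ℚ) f.denom ≠ 0 := RatFunc.algebraMap_ne_zero f.denom_ne_zero
    have hnd := RatFunc.num_div_denom f
    rw [div_eq_iff hd] at hnd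
    rw [map_mul, map_mul, map_mul, hnd, ← ee]
    simp only [map_pow, map_sub, map_one, RatFunc.algebraMap_X]
    rw [show RatFunc.X = q from rfl]
    linear_combination (algebraMap ℚ[X] (RatFunc ℚ) f.denom * algebraMap ℚ[X] (RatFunc ℚ) b) * hf
  refine hcop.dvd_of_dvd_mul_right ?_
  rw [key, hc, hs]
  exact ⟨s ^ e * c * f.denom, by ring⟩

theorem q_ne_zero : q ≠ 0 := RatFunc.X_ne_zero

theorem q_pow_ne_one {i : ℕ} (hi : 0 < i) : q ^ i ≠ 1 := by
  intro h
  have : (X : ℚ[X]) ^ i = 1 := RatFunc.algebraMap_injective ℚ (by simpa [q] using h)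
  have := congrArg natDegree this
  simp at this
  omega

theorem one_sub_q_pow_ne {i : ℕ} (hi : 0 < i) : 1 - q ^ i ≠ 0 :=
  one_sub_pow_ne (fun _ => q_pow_ne_one) hi

end Values

/-! ### Orders of vanishing at roots of unity, and vanishing of blocks. -/

section Orders

variable {ζ : ℂ} {d : ℕ}

/-- Here 1 - q^d serves as a uniformizer at ζ; orders of products then reduce to counting multiples
of d. -/
theorem exists_unit_factor (hζ : IsPrimitiveRoot ζ d) {e : ℕ} (he : 0 < e) :
    ∃ (u : RatFunc ℚ) (v : ℂ), v ≠ 0 ∧ HasVal ζ u v ∧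
      1 - q ^ e = (1 - q ^ d) ^ (if d ∣ e then 1 else 0) * u := by
  by_cases hd : d ∣ e
  · obtain ⟨c, rfl⟩ := hd
    refine ⟨∑ i ∈ Finset.range c, (q ^ d) ^ i, ∑ i ∈ Finset.range c, (ζ ^ d) ^ i, ?_,
      HasVal.sum fun i _ => (hasVal_q.pow d).pow i, ?_⟩
    · rw [hζ.pow_eq_one]
      simpa using (pos_of_mul_pos_right he (Nat.zero_le d)).ne'
    · rw [if_pos ⟨c, rfl⟩, pow_one, mul_comm (1 - q ^ d), geom_sum_mul_neg, pow_mul]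
  · refine ⟨1 - q ^ e, 1 - ζ ^ e, ?_, hasVal_one_sub_pow e, by simp [hd]⟩
    rw [sub_ne_zero]
    exact fun h => hd (hζ.dvd_of_pow_eq_one e h.symm)

theorem exists_unit_factor_prod (hζ : IsPrimitiveRoot ζ d) {e : ℕ → ℕ} (he : ∀ i, 0 < e i)
    (k : ℕ) :
    ∃ (u : RatFunc ℚ) (v : ℂ), v ≠ 0 ∧ HasVal ζ u v ∧ ∏ i ∈ Finset.range k, (1 - q ^ e i)
      = (1 - q ^ d) ^ (((Finset.range k).filter fun i => d ∣ e i).card) * u := by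
  choose u v hv hu heq using fun i => exists_unit_factor hζ (he i)
  refine ⟨∏ i ∈ Finset.range k, u i, ∏ i ∈ Finset.range k, v i,
    Finset.prod_ne_zero_iff.2 fun i _ => hv i, HasVal.prod fun i _ => hu i, ?_⟩
  rw [Finset.prod_congr rfl fun i _ => heq i, Finset.prod_mul_distrib, Finset.prod_pow_eq_pow_sum,
    Finset.card_filter]

theorem isRegular_prod_div (hζ : IsPrimitiveRoot ζ d) (hd : 0 < d) {e f : ℕ → ℕ}
    (he : ∀ i, 0 < e i) (hf : ∀ i, 0 < f i) {k : ℕ} {a b : ℕ}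
    (hcard : ((Finset.range k).filter fun i => d ∣ f i).card + b
      ≤ ((Finset.range k).filter fun i => d ∣ e i).card + a) :
    ∃ g, IsRegular ζ g ∧
      (1 - q ^ d) ^ a * ∏ i ∈ Finset.range k, (1 - q ^ e i) / (1 - q ^ f i)
        = (1 - q ^ d) ^ b * g := by
  obtain ⟨u, v, hv, hu, h1⟩ := exists_unit_factor_prod hζ he k
  obtain ⟨u', v', hv', hu', h2⟩ := exists_unit_factor_prod hζ hf k
  obtain ⟨c, hc⟩ := Nat.exists_eq_add_of_le hcard
  refine ⟨(1 - q ^ d) ^ c * (u / u'),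
    ((hasVal_one_sub_pow d).pow c).isRegular.mul (hu.div hu' hv').isRegular, ?_⟩
  have hu0 : u' ≠ 0 := by
    rintro rfl
    have := Finset.prod_ne_zero_iff.2 fun i (_ : i ∈ Finset.range k) => one_sub_q_pow_ne (hf i)
    exact this (by rw [h2, mul_zero])
  have hd0 := one_sub_q_pow_ne hd
  rw [Finset.prod_div_distrib, h1, h2, mul_div_assoc', div_eq_iff
    (mul_ne_zero (pow_ne_zero _ hd0) hu0), ← mul_assoc, ← pow_add, add_comm a, hc]
  field_simp
  ring

/-- Since 2i+2 - (2h+1) = 2(i-h)+1, the map i ↦ i - h injects the zeros of the denominator into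
those of the numerator. -/
theorem card_dvd_even_le {h : ℕ} (s : ℕ) (hs : s.Coprime (2 * h + 1)) (k : ℕ) :
    ((Finset.range k).filter fun i => 2 * h + 1 ∣ s * (2 * i + 2)).card
      ≤ ((Finset.range k).filter fun i => 2 * h + 1 ∣ s * (2 * i + 1)).card := by
  have key : ∀ i, 2 * h + 1 ∣ s * (2 * i + 2) → h ≤ i ∧ 2 * h + 1 ∣ s * (2 * (i - h) + 1) := by
    intro i hi
    have h1 := hs.symm.dvd_of_dvd_mul_left hi
    have h2 := Nat.le_of_dvd (by omega) h1
    refine ⟨by omega, Dvd.dvd.mul_left ?_ s⟩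
    have h3 := Nat.dvd_sub h1 (dvd_refl (2 * h + 1))
    rwa [show 2 * i + 2 - (2 * h + 1) = 2 * (i - h) + 1 by omega] at h3
  refine Finset.card_le_card_of_injOn (fun i => i - h) ?_ ?_
  · intro i hi
    simp only [Finset.coe_filter, Finset.mem_range, Set.mem_ofPred_eq] at hi ⊢
    exact ⟨by omega, (key i hi.2).2⟩
  · intro i hi j hj hij
    simp only [Finset.coe_filter, Finset.mem_range, Set.mem_ofPred_eq] at hi hj hij
    have := (key i hi.2).1
    have := (key j hj.2).1
    omega

theorem isRegular_oddEvenRatio {h s : ℕ} (hζ : IsPrimitiveRoot ζ (2 * h + 1)) (hs0 : 0 < s)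
    (hs : s.Coprime (2 * h + 1)) (k : ℕ) : IsRegular ζ (oddEvenRatio (q ^ s) k) := by
  obtain ⟨g, hg, e⟩ := isRegular_prod_div hζ (by omega) (e := fun i => s * (2 * i + 1))
    (f := fun i => s * (2 * i + 2)) (fun i => by positivity) (fun i => by positivity) (k := k)
    (a := 0) (b := 0) (by simpa using card_dvd_even_le s hs k)
  simp only [pow_zero, one_mul, pow_mul] at e
  rwa [oddEvenRatio, e]

theorem root_pow_ne_one {h : ℕ} (hζ : IsPrimitiveRoot ζ (2 * h + 1)) :
    ∀ i : ℕ, 0 < i → i < 2 * h + 1 → ζ ^ i ≠ 1 :=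
  fun _ h0 h1 => hζ.pow_ne_one_of_pos_of_lt h0.ne' h1

/-- Along a block of length `2h+1` the quotients behave like a multiple of the initial ones. -/
theorem hasVal_oddEvenRatio_block {h s : ℕ} (hζ : IsPrimitiveRoot ζ (2 * h + 1))
    (hs : s.Coprime (2 * h + 1)) {l : ℕ} {V : ℂ}
    (hV : HasVal ζ (oddEvenRatio (q ^ s) ((2 * h + 1) * l)) V) {r : ℕ} (hr : r < 2 * h + 1) :
    HasVal ζ (oddEvenRatio (q ^ s) ((2 * h + 1) * l + r)) (V * oddEvenRatio (ζ ^ s) r) := by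
  rw [oddEvenRatio, Finset.prod_range_add, ← oddEvenRatio]
  refine hV.mul (HasVal.prod fun i hi => ?_)
  have hi := Finset.mem_range.1 hi
  have e : ∀ j, (ζ ^ s) ^ (2 * ((2 * h + 1) * l + i) + j) = (ζ ^ s) ^ (2 * i + j) := by
    intro j
    rw [← pow_mul, ← pow_mul, show s * (2 * ((2 * h + 1) * l + i) + j)
      = (2 * h + 1) * (2 * l * s) + s * (2 * i + j) by ring, pow_add, pow_mul, hζ.pow_eq_one]
    simp
  rw [← e 1, ← e 2]
  refine HasVal.div (hasVal_one.sub ((hasVal_q.pow s).pow _))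
    (hasVal_one.sub ((hasVal_q.pow s).pow _)) ?_
  rw [e 2, sub_ne_zero, ← pow_mul]
  intro h1
  have h2 := hs.symm.dvd_of_dvd_mul_left (hζ.dvd_of_pow_eq_one _ h1.symm)
  obtain ⟨c, hc⟩ := h2
  -- Here i < r < 2h+1 forces 2i+2 < 2(2h+1), so the even number 2i+2 could only be 0 or the odd
  -- number 2h+1. At r = 2h+1 this would fail.
  have hc2 : c < 2 := by
    by_contra hcon
    have : (2 * h + 1) * 2 ≤ (2 * h + 1) * c := Nat.mul_le_mul_left _ (by omega)
    omega
  interval_cases c <;> omega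

theorem hasVal_poisedTerm_block {h : ℕ} (hh : 0 < h) (hζ : IsPrimitiveRoot ζ (2 * h + 1))
    {l : ℕ} {V V' : ℂ} (hV : HasVal ζ (oddEvenRatio (q ^ 1) ((2 * h + 1) * l)) V)
    (hV' : HasVal ζ (oddEvenRatio (q ^ 2) ((2 * h + 1) * l)) V') {r : ℕ} (hr : r < 2 * h + 1) :
    HasVal ζ (poisedTerm q ((2 * h + 1) * l + r))
      ((-ζ) ^ ((2 * h + 1) * l) * V' * V ^ 4 * poisedTerm ζ r) := by
  have h1 := hasVal_oddEvenRatio_block hζ (Nat.coprime_one_left _) hV hr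
  have h2 := hasVal_oddEvenRatio_block hζ (by simp) hV' hr
  rw [pow_one, pow_one] at h1
  have hζ1 : 1 - ζ ≠ 0 := by
    rw [sub_ne_zero]
    exact fun h1 => hζ.ne_one (by omega) h1.symm
  have h3 : HasVal ζ ((1 - q ^ (4 * ((2 * h + 1) * l + r) + 1)) / (1 - q))
      ((1 - ζ ^ (4 * r + 1)) / (1 - ζ)) := by
    have e : ζ ^ (4 * r + 1) = ζ ^ (4 * ((2 * h + 1) * l + r) + 1) := by
      rw [show 4 * ((2 * h + 1) * l + r) + 1 = (2 * h + 1) * (4 * l) + (4 * r + 1) by ring,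
        pow_add ζ ((2 * h + 1) * (4 * l)), pow_mul ζ (2 * h + 1), hζ.pow_eq_one]
      simp
    rw [e]
    exact (hasVal_one_sub_pow _).div (hasVal_one.sub hasVal_q) hζ1
  have := (h3.mul ((hasVal_q.neg.pow ((2 * h + 1) * l + r)).mul h2)).mul (h1.pow 4)
  rw [poisedTerm, poisedTerm, poisedCoeff, poisedCoeff, signedRatio_eq, signedRatio_eq]
  convert this using 1
  ring

theorem hasVal_poisedTerm {h : ℕ} (hh : 0 < h) (hζ : IsPrimitiveRoot ζ (2 * h + 1)) {k : ℕ}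
    (hk : k < 2 * h + 1) : HasVal ζ (poisedTerm q k) (poisedTerm ζ k) := by
  have h1 : ∀ s, HasVal ζ (oddEvenRatio (q ^ s) ((2 * h + 1) * 0)) 1 := fun s => by
    simpa [oddEvenRatio] using hasVal_one
  simpa using hasVal_poisedTerm_block hh hζ (h1 1) (h1 2) hk

theorem sum_poisedTerm_root {h : ℕ} (hζ : IsPrimitiveRoot ζ (2 * h + 1)) :
    ∑ k ∈ Finset.range (h + 1), poisedTerm ζ k = 0 := by
  simpa using sum_poisedTerm_mul_eq_zero hζ.pow_eq_one (root_pow_ne_one hζ) (fun _ => 1)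
    (fun _ _ => rfl)

theorem sum_poisedTerm_root_full {h : ℕ} (hζ : IsPrimitiveRoot ζ (2 * h + 1)) :
    ∑ k ∈ Finset.range (2 * h + 1), poisedTerm ζ k = 0 := by
  rw [show 2 * h + 1 = (h + 1) + h by ring, Finset.sum_range_add, sum_poisedTerm_root hζ, zero_add]
  exact Finset.sum_eq_zero fun k _ => poisedTerm_eq_zero hζ.pow_eq_one (by omega)

theorem hasVal_sum_block {h : ℕ} (hh : 0 < h) (hζ : IsPrimitiveRoot ζ (2 * h + 1)) (l r : ℕ)
    (hr : r ≤ 2 * h + 1) (h0 : ∑ k ∈ Finset.range r, poisedTerm ζ k = 0) :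
    HasVal ζ (∑ k ∈ Finset.range r, poisedTerm q ((2 * h + 1) * l + k)) 0 := by
  obtain ⟨V, hV⟩ := isRegular_oddEvenRatio hζ one_pos (Nat.coprime_one_left _) ((2 * h + 1) * l)
  obtain ⟨V', hV'⟩ := isRegular_oddEvenRatio hζ two_pos (by simp) ((2 * h + 1) * l)
  have := HasVal.sum fun k (hk : k ∈ Finset.range r) =>
    hasVal_poisedTerm_block hh hζ hV hV' (lt_of_lt_of_le (Finset.mem_range.1 hk) hr)
  rwa [← Finset.mul_sum, h0, mul_zero] at this

theorem hasVal_sum_full_blocks {h : ℕ} (hh : 0 < h) (hζ : IsPrimitiveRoot ζ (2 * h + 1)) (l : ℕ) :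
    HasVal ζ (∑ k ∈ Finset.range ((2 * h + 1) * l), poisedTerm q k) 0 := by
  induction l with
  | zero => simpa using hasVal_zero
  | succ l ih =>
    rw [mul_add, mul_one, Finset.sum_range_add]
    simpa using ih.add (hasVal_sum_block hh hζ l _ le_rfl (sum_poisedTerm_root_full hζ))

theorem hasVal_sum_half_blocks {h : ℕ} (hh : 0 < h) (hζ : IsPrimitiveRoot ζ (2 * h + 1)) (l : ℕ) :
    HasVal ζ (∑ k ∈ Finset.range ((2 * h + 1) * l + (h + 1)), poisedTerm q k) 0 := by
  rw [Finset.sum_range_add]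
  simpa using (hasVal_sum_full_blocks hh hζ l).add
    (hasVal_sum_block hh hζ l _ (by omega) (sum_poisedTerm_root hζ))

end Orders

theorem truncSum_eq (M : ℕ) : truncSum M = ∑ k ∈ Finset.range (M + 1), poisedTerm q k := by
  refine Finset.sum_congr rfl fun k _ => ?_
  have h1 : oddEvenRatio q k = qPoch q (q ^ 2) k / qPoch (q ^ 2) (q ^ 2) k := by
    rw [oddEvenRatio, Finset.prod_div_distrib, qPoch, qPoch]
    congr 1 <;> exact Finset.prod_congr rfl fun i _ => by ring
  have h2 : oddEvenRatio (q ^ 2) k = qPoch (q ^ 2) (q ^ 4) k / qPoch (q ^ 4) (q ^ 4) k := by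
    rw [oddEvenRatio, Finset.prod_div_distrib, qPoch, qPoch]
    congr 1 <;> exact Finset.prod_congr rfl fun i _ => by ring
  rw [poisedTerm, poisedCoeff, signedRatio_eq, h1, h2, qInt, neg_pow q, div_pow]
  field_simp

/-! ### Expansion of the well-poised ratio in δ = (1-w)²/w. -/

section Expansion

variable {ζ : ℂ} {δ : RatFunc ℚ}

theorem HasVal.ne_zero {f : RatFunc ℚ} {v : ℂ} (hf : HasVal ζ f v) (hv : v ≠ 0) : f ≠ 0 := by
  rintro rfl
  obtain ⟨a, b, hb, e, ea⟩ := hf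
  have : a = 0 := RatFunc.algebraMap_injective ℚ (by rw [← e, zero_mul, map_zero])
  rw [this, map_zero] at ea
  exact mul_ne_zero hv hb ea.symm

theorem IsRegular.neg {f : RatFunc ℚ} (hf : IsRegular ζ f) : IsRegular ζ (-f) :=
  let ⟨_, h⟩ := hf; ⟨_, h.neg⟩

theorem IsRegular.sub {f g : RatFunc ℚ} (hf : IsRegular ζ f) (hg : IsRegular ζ g) :
    IsRegular ζ (f - g) :=
  let ⟨_, h⟩ := hf; let ⟨_, h'⟩ := hg; ⟨_, h.sub h'⟩

theorem exists_factor_expansion (hδ : HasVal ζ δ 0) {a b : RatFunc ℚ} (ha : IsRegular ζ a)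
    (hb : IsRegular ζ b) :
    ∃ r, IsRegular ζ r ∧ (1 - δ * a) / (1 - δ * b) = 1 + δ * (b - a) + δ ^ 2 * r := by
  have h1 : HasVal ζ (1 - δ * b) 1 := by
    simpa using hasVal_one.sub (hδ.zero_mul_isRegular hb)
  have h0 := h1.ne_zero one_ne_zero
  refine ⟨b * (b - a) * (1 - δ * b)⁻¹,
    (hb.mul (hb.sub ha)).mul (h1.inv one_ne_zero).isRegular, ?_⟩
  field_simp
  ring

theorem exists_prod_expansion (hδ : HasVal ζ δ 0) {a b : ℕ → RatFunc ℚ} {k : ℕ}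
    (ha : ∀ i < k, IsRegular ζ (a i)) (hb : ∀ i < k, IsRegular ζ (b i)) :
    ∃ r, IsRegular ζ r ∧ ∏ i ∈ Finset.range k, (1 - δ * a i) / (1 - δ * b i)
      = 1 + δ * ∑ i ∈ Finset.range k, (b i - a i) + δ ^ 2 * r := by
  induction k with
  | zero => exact ⟨0, hasVal_zero.isRegular, by simp⟩
  | succ k ih =>
    obtain ⟨r, hr, e⟩ := ih (fun i hi => ha i (by omega)) (fun i hi => hb i (by omega))
    have hak := ha k (by omega)
    have hbk := hb k (by omega)
    obtain ⟨r', hr', e'⟩ := exists_factor_expansion hδ hak hbk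
    have hS : IsRegular ζ (∑ i ∈ Finset.range k, (b i - a i)) :=
      IsRegular.sum fun i hi => by
        have := Finset.mem_range.1 hi
        exact (hb i (by omega)).sub (ha i (by omega))
    have hδ' := hδ.isRegular
    rw [Finset.prod_range_succ, e, e', Finset.sum_range_succ]
    generalize ∑ i ∈ Finset.range k, (b i - a i) = S at *
    refine ⟨r + r' + S * (b k - a k) + δ * (S * r' + (b k - a k) * r) + δ ^ 2 * (r * r'), ?_, ?_⟩
    · exact ((((hr.add hr').add (hS.mul (hbk.sub hak))).add
        (hδ'.mul ((hS.mul hr').add ((hbk.sub hak).mul hr)))).add ((hδ'.pow 2).mul (hr.mul hr')))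
    · ring

theorem hasVal_koebe {j : ℕ} (hj : ζ ^ j ≠ 1) : HasVal ζ (koebe q j) (koebe ζ j) :=
  (hasVal_q.pow j).div ((hasVal_one_sub_pow j).pow 2)
    (pow_ne_zero _ (sub_ne_zero.2 hj.symm))

/-- Divided by w, the left side is invariant under w ↦ 1/w, hence a function of δ. With w = q^n, δ
vanishes doubly at ζ, so a first-order expansion in δ is accurate to order four. -/
theorem poised_factor {w : RatFunc ℚ} (hw : w ≠ 0) {j : ℕ} (hj : 0 < j) :
    (1 - q ^ j * w) * (w - q ^ j) = w * (1 - q ^ j) ^ 2 * (1 - (1 - w) ^ 2 / w * koebe q j) := by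
  have := one_sub_q_pow_ne hj
  rw [koebe]
  generalize hA : 1 - q ^ j = A at *
  field_simp
  rw [← hA]
  ring

theorem poisedRatio_eq_mul_prod {w : RatFunc ℚ} (hw : w ≠ 0) {s : ℕ} (hs : 0 < s) (k : ℕ) :
    poisedRatio (q ^ s) w k = oddEvenRatio (q ^ s) k ^ 2 * ∏ i ∈ Finset.range k,
      (1 - (1 - w) ^ 2 / w * koebe q (s * (2 * i + 1)))
        / (1 - (1 - w) ^ 2 / w * koebe q (s * (2 * i + 2))) := by
  rw [poisedRatio, oddEvenRatio, ← Finset.prod_pow, ← Finset.prod_mul_distrib]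
  refine Finset.prod_congr rfl fun i _ => ?_
  rw [← pow_mul, ← pow_mul, poised_factor hw (by positivity), poised_factor hw (by positivity),
    div_pow, div_mul_div_comm, mul_assoc, mul_assoc, mul_div_mul_left _ _ hw]

theorem koebe_pow (s j : ℕ) : koebe (q ^ s) j = koebe q (s * j) := by
  rw [koebe, koebe, pow_mul]

theorem exists_poisedRatio_expansion {n s k : ℕ} (hζ : IsPrimitiveRoot ζ n) (hs : 0 < s)
    (hk : s * (2 * k) < n) :
    ∃ r, IsRegular ζ r ∧ poisedRatio (q ^ s) (q ^ n) k = oddEvenRatio (q ^ s) k ^ 2 *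
      (1 + (1 - q ^ n) ^ 2 / q ^ n * logDerivSum (q ^ s) k
        + ((1 - q ^ n) ^ 2 / q ^ n) ^ 2 * r) := by
  have hδ : HasVal ζ ((1 - q ^ n) ^ 2 / q ^ n) 0 := by
    have := ((hasVal_one_sub_pow (ζ := ζ) n).pow 2).div (hasVal_q.pow n)
      (by rw [hζ.pow_eq_one]; exact one_ne_zero)
    simpa [hζ.pow_eq_one] using this
  have reg : ∀ j, 0 < j → j ≤ 2 * k → IsRegular ζ (koebe q (s * j)) := fun j hj hjk =>
    (hasVal_koebe (hζ.pow_ne_one_of_pos_of_lt (by positivity)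
      (lt_of_le_of_lt (Nat.mul_le_mul_left s hjk) hk))).isRegular
  obtain ⟨r, hr, e⟩ := exists_prod_expansion hδ (k := k)
    (a := fun i => koebe q (s * (2 * i + 1))) (b := fun i => koebe q (s * (2 * i + 2)))
    (fun i hi => reg _ (by omega) (by omega)) (fun i hi => reg _ (by omega) (by omega))
  refine ⟨r, hr, ?_⟩
  rw [poisedRatio_eq_mul_prod (pow_ne_zero _ q_ne_zero) hs, e, logDerivSum]
  simp only [koebe_pow]

end Expansion

/-! ### The truncated sum to fifth order at primitive n-th roots of unity. -/

section TopOrder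

variable {ζ : ℂ} {m : ℕ}

/-- The error is the sum of c_k (u_k(w) - u_k(1))² with w = q^(2m+1). Its factor δ² is (1-w)⁴/w²,
and the cofactor vanishes at ζ by antisymmetry. -/
theorem exists_half_sum_expansion (hm : 0 < m) (hζ : IsPrimitiveRoot ζ (2 * m + 1)) :
    ∃ T, HasVal ζ T 0 ∧ ∑ k ∈ Finset.range (m + 1), poisedTerm q k
      = 2 * poisedSum q 1 m - poisedSum q (q ^ (2 * m + 1)) m
        + (1 - q ^ (2 * m + 1)) ^ 4 * T := by
  set w := q ^ (2 * m + 1) with hw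
  have hw0 : w ≠ 0 := pow_ne_zero _ q_ne_zero
  have hwv : HasVal ζ w 1 := by
    have := hasVal_q (ζ := ζ).pow (2 * m + 1)
    rwa [hζ.pow_eq_one] at this
  have hδ : HasVal ζ ((1 - w) ^ 2 / w) 0 := by
    simpa using ((hasVal_one.sub hwv).pow 2).div hwv one_ne_zero
  have hex : ∀ k, ∃ r, k ∈ Finset.range (m + 1) → IsRegular ζ r ∧
      poisedRatio q w k = oddEvenRatio q k ^ 2 *
      (1 + (1 - w) ^ 2 / w * logDerivSum q k + ((1 - w) ^ 2 / w) ^ 2 * r) := by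
    intro k
    by_cases hk : k ∈ Finset.range (m + 1)
    · have hk' := Finset.mem_range.1 hk
      obtain ⟨r, hr, e⟩ := exists_poisedRatio_expansion hζ one_pos (k := k) (by omega)
      rw [pow_one] at e
      exact ⟨r, fun _ => ⟨hr, e⟩⟩
    · exact ⟨0, fun h => absurd h hk⟩
  choose r hr using hex
  refine ⟨(w ^ 2)⁻¹ * ∑ k ∈ Finset.range (m + 1),
    poisedTerm q k * (logDerivSum q k + (1 - w) ^ 2 / w * r k) ^ 2, ?_, ?_⟩
  · have hL : ∀ k ∈ Finset.range (m + 1), HasVal ζ (logDerivSum q k) (logDerivSum ζ k) := by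
      intro k hk
      refine HasVal.sum fun i hi => ?_
      have hk := Finset.mem_range.1 hk
      have hi := Finset.mem_range.1 hi
      exact (hasVal_koebe (root_pow_ne_one hζ _ (by omega) (by omega))).sub
        (hasVal_koebe (root_pow_ne_one hζ _ (by omega) (by omega)))
    have hsum : HasVal ζ (∑ k ∈ Finset.range (m + 1),
        poisedTerm q k * (logDerivSum q k + (1 - w) ^ 2 / w * r k) ^ 2)
        (∑ k ∈ Finset.range (m + 1), poisedTerm ζ k * logDerivSum ζ k ^ 2) := by
      refine HasVal.sum fun k hk => ?_
      have := (hL k hk).add (hδ.zero_mul_isRegular (hr k hk).1)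
      rw [add_zero] at this
      exact (hasVal_poisedTerm hm hζ (by have := Finset.mem_range.1 hk; omega)).mul (this.pow 2)
    rw [sum_poisedTerm_mul_eq_zero hζ.pow_eq_one (root_pow_ne_one hζ)
      (fun k => logDerivSum ζ k ^ 2)
      (fun k hk => by rw [logDerivSum_reflect hζ.pow_eq_one hk])] at hsum
    simpa using ((hwv.pow 2).inv (by simp)).mul hsum
  · rw [poisedSum, poisedSum, ← hw, Finset.mul_sum, Finset.mul_sum, Finset.mul_sum,
      ← Finset.sum_sub_distrib, ← Finset.sum_add_distrib]
    refine Finset.sum_congr rfl fun k hk => ?_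
    rw [poisedRatio_one, (hr k hk).2, poisedTerm]
    field_simp
    ring

theorem exists_oddEvenRatio_eq_mul {s k : ℕ} (hζ : IsPrimitiveRoot ζ (2 * m + 1)) (hs0 : 0 < s)
    (hs : s.Coprime (2 * m + 1)) (hk : m < k) (hk2 : k < 2 * m + 1) :
    ∃ g, IsRegular ζ g ∧ oddEvenRatio (q ^ s) k = (1 - q ^ (2 * m + 1)) * g := by
  have hF : (Finset.range k).filter (fun i => 2 * m + 1 ∣ s * (2 * i + 2)) = ∅ := by
    refine Finset.filter_eq_empty_iff.2 fun i hi hdvd => ?_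
    have hi := Finset.mem_range.1 hi
    obtain ⟨c, hc⟩ := hs.symm.dvd_of_dvd_mul_left hdvd
    have hc2 : c < 2 := by
      by_contra hcon
      have : (2 * m + 1) * 2 ≤ (2 * m + 1) * c := Nat.mul_le_mul_left _ (by omega)
      omega
    interval_cases c <;> omega
  have hE : 0 < ((Finset.range k).filter (fun i => 2 * m + 1 ∣ s * (2 * i + 1))).card :=
    Finset.card_pos.2 ⟨m, by simp [hk]⟩
  obtain ⟨g, hg, e⟩ := isRegular_prod_div hζ (by omega) (e := fun i => s * (2 * i + 1))
    (f := fun i => s * (2 * i + 2)) (fun i => by positivity) (fun i => by positivity) (k := k)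
    (a := 0) (b := 1) (by rw [hF, Finset.card_empty]; omega)
  simp only [pow_zero, one_mul, pow_one] at e
  refine ⟨g, hg, ?_⟩
  rw [← e, oddEvenRatio]
  simp only [← pow_mul]

/-- Each tail term has order at least five: four from r_k⁴ and one from the base q² ratio. -/
theorem exists_sum_tail (hm : 0 < m) (hζ : IsPrimitiveRoot ζ (2 * m + 1)) :
    ∃ T, HasVal ζ T 0 ∧ ∑ k ∈ Finset.range m, poisedTerm q (m + 1 + k)
      = (1 - q ^ (2 * m + 1)) ^ 4 * T := by
  have hex : ∀ k ∈ Finset.range m, ∃ T, HasVal ζ T 0 ∧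
      poisedTerm q (m + 1 + k) = (1 - q ^ (2 * m + 1)) ^ 4 * T := by
    intro k hk
    have hk := Finset.mem_range.1 hk
    obtain ⟨g, hg, e⟩ := exists_oddEvenRatio_eq_mul hζ one_pos (Nat.coprime_one_left _)
      (k := m + 1 + k) (by omega) (by omega)
    obtain ⟨g', hg', e'⟩ := exists_oddEvenRatio_eq_mul hζ two_pos (by simp)
      (k := m + 1 + k) (by omega) (by omega)
    have h0 : HasVal ζ (1 - q ^ (2 * m + 1)) 0 := by
      simpa [hζ.pow_eq_one] using hasVal_one_sub_pow (ζ := ζ) (2 * m + 1)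
    have h1 : HasVal ζ ((1 - q ^ (4 * (m + 1 + k) + 1)) / (1 - q)) _ :=
      (hasVal_one_sub_pow _).div (hasVal_one.sub hasVal_q)
        (sub_ne_zero.2 (hζ.ne_one (by omega)).symm)
    rw [pow_one] at e
    refine ⟨(1 - q ^ (2 * m + 1)) * ((1 - q ^ (4 * (m + 1 + k) + 1)) / (1 - q)
      * ((-q) ^ (m + 1 + k) * g') * g ^ 4), h0.zero_mul_isRegular ((h1.isRegular.mul
      (((hasVal_q.neg.pow _).isRegular).mul hg')).mul (hg.pow 4)), ?_⟩
    rw [poisedTerm, poisedCoeff, signedRatio_eq, e, e']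
    ring
  choose! T hT using hex
  refine ⟨∑ k ∈ Finset.range m, T k, ?_, ?_⟩
  · simpa using HasVal.sum fun k hk => (hT k hk).1
  · rw [Finset.mul_sum]
    exact Finset.sum_congr rfl fun k hk => (hT k hk).2

theorem exists_truncSum_expansion (hm : 0 < m) (hζ : IsPrimitiveRoot ζ (2 * m + 1)) {M : ℕ}
    (hM : M = m ∨ M = 2 * m) :
    ∃ T, HasVal ζ T 0 ∧ truncSum M
      = 2 * poisedSum q 1 m - poisedSum q (q ^ (2 * m + 1)) m
        + (1 - q ^ (2 * m + 1)) ^ 4 * T := by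
  obtain ⟨T, hT, e⟩ := exists_half_sum_expansion hm hζ
  rcases hM with rfl | rfl
  · exact ⟨T, hT, by rw [truncSum_eq, e]⟩
  · obtain ⟨T', hT', e'⟩ := exists_sum_tail hm hζ
    refine ⟨T + T', by simpa using hT.add hT', ?_⟩
    rw [truncSum_eq, show 2 * m + 1 = m + 1 + m by ring, Finset.sum_range_add, e, e',
      show m + 1 + m = 2 * m + 1 by ring]
    ring

end TopOrder

theorem one_sub_q_ne : 1 - q ≠ 0 := by simpa using one_sub_q_pow_ne one_pos

theorem hasVal_qInt_zero {ζ : ℂ} {d n : ℕ} (hζ : IsPrimitiveRoot ζ d) (hd : 1 < d) (hdn : d ∣ n) :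
    HasVal ζ (qInt n) 0 := by
  have := (hasVal_one_sub_pow (ζ := ζ) n).div (hasVal_one.sub hasVal_q)
    (sub_ne_zero.2 (hζ.ne_one hd).symm)
  rwa [(hζ.pow_eq_one_iff_dvd n).2 hdn, sub_self, zero_div] at this

/-! ### The case n ≡ 1 (mod 4). -/

section CaseOne

theorem logDerivSum_sq_eq (j : ℕ) :
    logDerivSum (q ^ 2) j = -∑ i ∈ Finset.Icc 1 (2 * j), (-1) ^ (i + 1) * koebe q (2 * i) := by
  induction j with
  | zero => simp [logDerivSum]
  | succ j ih =>
    rw [logDerivSum, Finset.sum_range_succ, ← logDerivSum, ih, show 2 * (j + 1) = 2 * j + 1 + 1 by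
      ring, Finset.sum_Icc_succ_top (by omega), Finset.sum_Icc_succ_top (by omega), koebe_pow,
      koebe_pow]
    have h1 : (-1 : RatFunc ℚ) ^ (2 * j + 1 + 1) = 1 := Even.neg_one_pow ⟨j + 1, by ring⟩
    rw [pow_succ _ (2 * j + 1 + 1), h1]
    ring

theorem correction_sum_eq (n j : ℕ) :
    qInt n ^ 2 * ∑ i ∈ Finset.Icc 1 (2 * j),
        (-1) ^ (i + 1) * q ^ (2 * (i : ℤ) - (n : ℤ)) / qInt (2 * i) ^ 2
      = -((1 - q ^ n) ^ 2 / q ^ n * logDerivSum (q ^ 2) j) := by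
  rw [logDerivSum_sq_eq, Finset.mul_sum, mul_neg, neg_neg, Finset.mul_sum]
  refine Finset.sum_congr rfl fun i hi => ?_
  have hi := (Finset.mem_Icc.1 hi).1
  have e : q ^ (2 * (i : ℤ) - (n : ℤ)) = q ^ (2 * i) / q ^ n := by
    rw [zpow_sub₀ q_ne_zero]
    norm_cast
  rw [e, koebe, qInt, qInt]
  have h1 := one_sub_q_ne
  have h2 := one_sub_q_pow_ne (i := 2 * i) (by omega)
  have h3 := pow_ne_zero n q_ne_zero
  generalize 1 - q ^ (2 * i) = A at *
  generalize 1 - q = B at *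
  generalize q ^ n = w at *
  field_simp

theorem oddEvenRatio_sq_eq (k : ℕ) :
    oddEvenRatio (q ^ 2) k ^ 2 = qPoch (q ^ 2) (q ^ 4) k ^ 2 / qPoch (q ^ 4) (q ^ 4) k ^ 2 := by
  rw [oddEvenRatio, Finset.prod_div_distrib, qPoch, qPoch, div_pow]
  congr 2 <;> exact Finset.prod_congr rfl fun i _ => by ring

theorem poisedSum_even_q {y : RatFunc ℚ} (hy1 : ∀ i : ℕ, y - q ^ (2 * i + 2) ≠ 0)
    (hy2 : ∀ i : ℕ, 1 - q ^ (2 * i + 2) * y ≠ 0) (j : ℕ) :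
    poisedSum q y (2 * j) = qInt (4 * j + 1) * poisedRatio (q ^ 2) y j := by
  rw [poisedSum_even q_ne_zero (fun _ => q_pow_ne_one) hy1 hy2, qInt, poisedRatio]
  congr 1
  refine Finset.prod_congr rfl fun i _ => ?_
  rw [← pow_mul, ← pow_mul]
  ring_nf

theorem one_sub_ne (i : ℕ) : (1 : RatFunc ℚ) - q ^ (2 * i + 2) ≠ 0 := one_sub_q_pow_ne (by omega)

theorem odd_pow_sub_ne (m i : ℕ) : q ^ (2 * m + 1) - q ^ (2 * i + 2) ≠ 0 :=
  pow_sub_pow_ne q_ne_zero (fun _ => q_pow_ne_one) (by omega)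

theorem one_sub_mul_odd_pow_ne (m i : ℕ) : 1 - q ^ (2 * i + 2) * q ^ (2 * m + 1) ≠ 0 := by
  rw [← pow_add]
  exact one_sub_q_pow_ne (by omega)

/-- The right-hand side for `n = 4j + 1`. -/
noncomputable def evenValue (j : ℕ) : RatFunc ℚ :=
  qInt (4 * j + 1) * oddEvenRatio (q ^ 2) j ^ 2
    * (1 - (1 - q ^ (4 * j + 1)) ^ 2 / q ^ (4 * j + 1) * logDerivSum (q ^ 2) j)

theorem top_order_even {ζ : ℂ} {j : ℕ} (hj : 0 < j) (hζ : IsPrimitiveRoot ζ (4 * j + 1)) {M : ℕ}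
    (hM : M = 2 * j ∨ M = 4 * j) :
    ∃ T, HasVal ζ T 0 ∧ truncSum M - evenValue j = (1 - q ^ (4 * j + 1)) ^ 4 * T := by
  have e4 : 4 * j + 1 = 2 * (2 * j) + 1 := by ring
  obtain ⟨T, hT, e⟩ := exists_truncSum_expansion (m := 2 * j) (by omega) (by rwa [← e4])
    (M := M) (by omega)
  obtain ⟨r, hr, er⟩ := exists_poisedRatio_expansion hζ two_pos (k := j) (by omega)
  rw [poisedSum_even_q (fun i => one_sub_ne i) (fun i => by simpa using one_sub_ne i),
    poisedSum_even_q (odd_pow_sub_ne _) (one_sub_mul_odd_pow_ne _), ← e4, er,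
    poisedRatio_one] at e
  have hB := isRegular_oddEvenRatio (h := 2 * j) (by rwa [← e4]) two_pos (by simp) j
  have hw : HasVal ζ (q ^ (4 * j + 1)) 1 := by
    have := (hasVal_q (ζ := ζ)).pow (4 * j + 1)
    rwa [hζ.pow_eq_one] at this
  have h0 := hasVal_qInt_zero hζ (by omega) (dvd_refl _)
  -- From 2 - (1 + δL + δ²r) = 1 - δL - δ²r, the discarded part carries δ², and the prefactor [n]
  -- supplies the fifth zero.
  refine ⟨T + qInt (4 * j + 1) * -(oddEvenRatio (q ^ 2) j ^ 2 * r * ((q ^ (4 * j + 1)) ^ 2)⁻¹),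
    ?_, ?_⟩
  · simpa using hT.add (h0.zero_mul_isRegular ((((hB.pow 2).mul hr).mul
      (((hw.pow 2).inv (by simp)).isRegular)).neg))
  · rw [e, evenValue]
    have := pow_ne_zero (4 * j + 1) q_ne_zero
    generalize q ^ (4 * j + 1) = w at *
    field_simp
    ring

theorem isRegular_div_one_sub_pow {ζ : ℂ} {d n e : ℕ} (hζ : IsPrimitiveRoot ζ d) (hd : 0 < d)
    (hn : 0 < n) (hdn : d ∣ n) (he : 0 < e) : IsRegular ζ ((1 - q ^ n) / (1 - q ^ e)) := by
  obtain ⟨g, hg, h⟩ := isRegular_prod_div hζ hd (e := fun _ => n) (f := fun _ => e)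
    (fun _ => hn) (fun _ => he) (k := 1) (a := 0) (b := 0) (by
      simp only [hdn, Finset.filter_true, add_zero]
      exact Finset.card_filter_le _ _)
  simp only [pow_zero, one_mul, Finset.prod_range_one] at h
  rwa [h]

/-- The poles of `logDerivSum` at ζ are at most double and are cancelled by (1 - q^n)², so the outer
factor [n] forces vanishing. -/
theorem lower_order_even {ζ : ℂ} {j h : ℕ} (hh : 0 < h) (hζ : IsPrimitiveRoot ζ (2 * h + 1))
    (hd : 2 * h + 1 ∣ 4 * j + 1) : HasVal ζ (evenValue j) 0 := by
  have hB := isRegular_oddEvenRatio hζ two_pos (by simp) j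
  have hw : HasVal ζ (q ^ (4 * j + 1)) 1 := by
    have := (hasVal_q (ζ := ζ)).pow (4 * j + 1)
    rwa [(hζ.pow_eq_one_iff_dvd _).2 hd] at this
  have hS : IsRegular ζ ((1 - q ^ (4 * j + 1)) ^ 2 / q ^ (4 * j + 1) * logDerivSum (q ^ 2) j) := by
    have e : ∀ i, 0 < i → IsRegular ζ
        ((1 - q ^ (4 * j + 1)) ^ 2 / q ^ (4 * j + 1) * koebe q (2 * i)) := by
      intro i hi
      have := (((hasVal_q (ζ := ζ)).pow (2 * i)).isRegular.mul
        ((isRegular_div_one_sub_pow hζ (by omega) (by omega) hd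
          (show 0 < 2 * i by omega)).pow 2)).mul (hw.inv one_ne_zero).isRegular
      convert this using 1
      rw [koebe, div_pow, div_eq_mul_inv, div_eq_mul_inv, div_eq_mul_inv]
      ring
    rw [logDerivSum, Finset.mul_sum]
    refine IsRegular.sum fun i _ => ?_
    rw [koebe_pow, koebe_pow, mul_sub]
    exact (e _ (by omega)).sub (e _ (by omega))
  rw [evenValue, mul_assoc]
  exact (hasVal_qInt_zero hζ (by omega) hd).zero_mul_isRegular
    ((hB.pow 2).mul (hasVal_one.isRegular.sub hS))

end CaseOne

/-! ### The case n ≡ 3 (mod 4). -/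

section CaseThree

/-- The right-hand side for `n = 4j + 3`. -/
noncomputable def oddValue (j : ℕ) : RatFunc ℚ :=
  qInt (4 * j + 3) ^ 2 * (q ^ (2 * j + 1))⁻¹
    * ∏ i ∈ Finset.range (2 * j + 1), (1 - q ^ (4 * i + 3)) / (1 - q ^ (4 * i + 5))

/-- The exponents lie symmetrically about n = 4j+3: the middle one is n, the others are n ± (4i+4).
In `prod_one_mod_four` they are n ± (4i+2). This matches the factors (1 - q^e w)(w - q^e) at w =
q^n. -/
theorem prod_three_mod_four (j : ℕ) :
    ∏ i ∈ Finset.range (2 * j + 1), (1 - q ^ (4 * i + 3))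
      = (1 - q ^ (4 * j + 3)) * ∏ i ∈ Finset.range j,
        (1 - q ^ (4 * i + 4 + (4 * j + 3))) * (1 - q ^ (4 * (j - 1 - i) + 3)) := by
  rw [show 2 * j + 1 = j + (1 + j) by ring, Finset.prod_range_add, Finset.prod_range_add,
    Finset.prod_mul_distrib, Finset.prod_range_reflect (fun i => 1 - q ^ (4 * i + 3)) j]
  have : ∏ x ∈ Finset.range j, (1 - q ^ (4 * (j + (1 + x)) + 3))
      = ∏ i ∈ Finset.range j, (1 - q ^ (4 * i + 4 + (4 * j + 3))) :=
    Finset.prod_congr rfl fun i _ => by ring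
  rw [this]
  simp only [Finset.prod_range_one, add_zero]
  ring

theorem prod_one_mod_four (j : ℕ) :
    (1 - q) * ∏ i ∈ Finset.range (2 * j + 1), (1 - q ^ (4 * i + 5))
      = ∏ i ∈ Finset.range (j + 1),
        (1 - q ^ (4 * i + 2 + (4 * j + 3))) * (1 - q ^ (4 * (j - i) + 1)) := by
  have h1 : (1 - q) * ∏ i ∈ Finset.range (2 * j + 1), (1 - q ^ (4 * i + 5))
      = ∏ i ∈ Finset.range (2 * j + 2), (1 - q ^ (4 * i + 1)) := by
    rw [Finset.prod_range_succ' _ (2 * j + 1), mul_comm]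
    simp [mul_add]
  have h2 := Finset.prod_range_reflect (fun i => 1 - q ^ (4 * i + 1)) (j + 1)
  rw [Nat.add_sub_cancel] at h2
  rw [h1, show 2 * j + 2 = (j + 1) + (j + 1) by ring, Finset.prod_range_add,
    Finset.prod_mul_distrib, h2, mul_comm]
  congr 1
  exact Finset.prod_congr rfl fun i _ => by ring

theorem prod_neg_pow_eq (j : ℕ) :
    q * q ^ (2 * j + 1) * ∏ i ∈ Finset.range j, -q ^ (4 * i + 4)
      = -∏ i ∈ Finset.range (j + 1), -q ^ (4 * i + 2) := by
  induction j with
  | zero => simp; ring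
  | succ j ih =>
    rw [Finset.prod_range_succ, Finset.prod_range_succ _ (j + 1)]
    linear_combination -q ^ (4 * j + 6) * ih

theorem poisedSum_odd_q (j : ℕ) :
    poisedSum q (q ^ (2 * (2 * j + 1) + 1)) (2 * j + 1) = -oddValue j := by
  rw [poisedSum_odd q_ne_zero (fun _ => q_pow_ne_one) (odd_pow_sub_ne _)
    (one_sub_mul_odd_pow_ne _)]
  have e3 : 2 * (2 * j + 1) + 1 = 4 * j + 3 := by ring
  rw [e3]
  set w := q ^ (4 * j + 3) with hw
  have num : ∏ i ∈ Finset.range j, (1 - q ^ (4 * i + 4) * w) * (w - q ^ (4 * i + 4))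
      = (∏ i ∈ Finset.range j, -q ^ (4 * i + 4)) * ∏ i ∈ Finset.range j,
        (1 - q ^ (4 * i + 4 + (4 * j + 3))) * (1 - q ^ (4 * (j - 1 - i) + 3)) := by
    rw [← Finset.prod_mul_distrib]
    refine Finset.prod_congr rfl fun i hi => ?_
    have hi := Finset.mem_range.1 hi
    have : w = q ^ (4 * i + 4) * q ^ (4 * (j - 1 - i) + 3) := by
      rw [← pow_add, hw]; congr 1; omega
    rw [pow_add _ (4 * i + 4) (4 * j + 3), ← hw]
    linear_combination (1 - q ^ (4 * i + 4) * w) * this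
  have den : (1 - q ^ 2 * w) * (w - q ^ 2)
        * ∏ i ∈ Finset.range j, (1 - q ^ (4 * i + 6) * w) * (w - q ^ (4 * i + 6))
      = (∏ i ∈ Finset.range (j + 1), -q ^ (4 * i + 2)) * ∏ i ∈ Finset.range (j + 1),
        (1 - q ^ (4 * i + 2 + (4 * j + 3))) * (1 - q ^ (4 * (j - i) + 1)) := by
    rw [← Finset.prod_mul_distrib]
    have : ∏ i ∈ Finset.range (j + 1), (1 - q ^ (4 * i + 2) * w) * (w - q ^ (4 * i + 2))
        = (1 - q ^ 2 * w) * (w - q ^ 2)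
        * ∏ i ∈ Finset.range j, (1 - q ^ (4 * i + 6) * w) * (w - q ^ (4 * i + 6)) := by
      rw [Finset.prod_range_succ', mul_comm]
      simp [mul_add]
    rw [← this]
    refine Finset.prod_congr rfl fun i hi => ?_
    have hi := Finset.mem_range.1 hi
    have : w = q ^ (4 * i + 2) * q ^ (4 * (j - i) + 1) := by
      rw [← pow_add, hw]; congr 1; omega
    rw [pow_add _ (4 * i + 2) (4 * j + 3), ← hw]
    linear_combination (1 - q ^ (4 * i + 2) * w) * this
  have sgn := prod_neg_pow_eq j
  have p3 := prod_three_mod_four j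
  have p1 := prod_one_mod_four j
  have nz : ∏ i ∈ Finset.range (2 * j + 1), (1 - q ^ (4 * i + 5)) ≠ 0 :=
    Finset.prod_ne_zero_iff.2 fun i _ => one_sub_q_pow_ne (by omega)
  have nz2 : ∏ i ∈ Finset.range (j + 1), -q ^ (4 * i + 2) ≠ 0 :=
    Finset.prod_ne_zero_iff.2 fun i _ => neg_ne_zero.2 (pow_ne_zero _ q_ne_zero)
  have nz3 : q ^ (2 * j + 1) ≠ 0 := pow_ne_zero _ q_ne_zero
  have nz4 := one_sub_q_ne
  rw [← p1] at den
  rw [Finset.prod_div_distrib, div_mul_div_comm, den, num, oddValue, Finset.prod_div_distrib, p3,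
    qInt, ← hw]
  generalize ∏ i ∈ Finset.range (2 * j + 1), (1 - q ^ (4 * i + 5)) = A at *
  generalize ∏ i ∈ Finset.range (j + 1), -q ^ (4 * i + 2) = B at *
  generalize ∏ i ∈ Finset.range j, -q ^ (4 * i + 4) = C at *
  generalize ∏ i ∈ Finset.range j, ((1 - q ^ (4 * i + 4 + (4 * j + 3)))
    * (1 - q ^ (4 * (j - 1 - i) + 3))) = D at *
  generalize q ^ (2 * j + 1) = E at *
  generalize 1 - q = F at *
  field_simp
  linear_combination ((1 - w) ^ 3 * D) * sgn

theorem poisedSum_odd_one (j : ℕ) : poisedSum q 1 (2 * j + 1) = 0 := by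
  rw [poisedSum_odd q_ne_zero (fun _ => q_pow_ne_one) (fun i => one_sub_ne i)
    (fun i => by simpa using one_sub_ne i)]
  simp

theorem top_order_odd {ζ : ℂ} {j : ℕ} (hζ : IsPrimitiveRoot ζ (4 * j + 3)) {M : ℕ}
    (hM : M = 2 * j + 1 ∨ M = 4 * j + 2) :
    ∃ T, HasVal ζ T 0 ∧ truncSum M - oddValue j = (1 - q ^ (4 * j + 3)) ^ 4 * T := by
  have e3 : 4 * j + 3 = 2 * (2 * j + 1) + 1 := by ring
  obtain ⟨T, hT, e⟩ := exists_truncSum_expansion (m := 2 * j + 1) (by omega) (by rwa [← e3])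
    (M := M) (by omega)
  refine ⟨T, hT, ?_⟩
  rw [e, poisedSum_odd_q, poisedSum_odd_one, ← e3]
  ring

/-- For i ≥ h use i ↦ i - h, since 4i+5 - 2(2h+1) = 4(i-h)+3. For i < h the only possible multiple
is 2h+1 itself, whence one extra pole at most. -/
theorem card_dvd_one_mod_four_le (h k : ℕ) :
    ((Finset.range k).filter fun i => 2 * h + 1 ∣ 4 * i + 5).card
      ≤ ((Finset.range k).filter fun i => 2 * h + 1 ∣ 4 * i + 3).card + 1 := by
  rw [← Finset.card_filter_add_card_filter_not (s := (Finset.range k).filter _)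
    (fun i => h ≤ i)]
  refine Nat.add_le_add ?_ ?_
  · refine Finset.card_le_card_of_injOn (fun i => i - h) ?_ ?_
    · intro i hi
      simp only [Finset.coe_filter, Finset.mem_filter, Finset.mem_range,
        Set.mem_ofPred_eq] at hi ⊢
      obtain ⟨⟨h1, h2⟩, h3⟩ := hi
      have h4 := Nat.dvd_sub h2 (Dvd.intro 2 rfl : 2 * h + 1 ∣ (2 * h + 1) * 2)
      rw [show 4 * i + 5 - (2 * h + 1) * 2 = 4 * (i - h) + 3 by omega] at h4
      exact ⟨by omega, h4⟩
    · intro i hi j hj hij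
      simp only [Finset.coe_filter, Finset.mem_filter, Finset.mem_range,
        Set.mem_ofPred_eq] at hi hj hij
      omega
  · have key : ∀ i, 2 * h + 1 ∣ 4 * i + 5 → ¬ h ≤ i → 4 * i + 5 = 2 * h + 1 := by
      rintro i ⟨c, hc⟩ hi
      have hc2 : c < 2 := by
        by_contra hcon
        have : (2 * h + 1) * 2 ≤ (2 * h + 1) * c := Nat.mul_le_mul_left _ (by omega)
        omega
      interval_cases c <;> omega
    refine Finset.card_le_one.2 fun i hi j hj => ?_
    simp only [Finset.mem_filter] at hi hj
    have := key i hi.1.2 hi.2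
    have := key j hj.1.2 hj.2
    omega

/-- One factor [n] absorbs the possible simple pole of the product; the other gives the zero. -/
theorem lower_order_odd {ζ : ℂ} {j h : ℕ} (hh : 0 < h) (hζ : IsPrimitiveRoot ζ (2 * h + 1))
    (hd : 2 * h + 1 ∣ 4 * j + 3) : HasVal ζ (oddValue j) 0 := by
  obtain ⟨g, hg, e⟩ := isRegular_prod_div hζ (by omega) (e := fun i => 4 * i + 3)
    (f := fun i => 4 * i + 5) (fun i => by positivity) (fun i => by positivity)
    (k := 2 * j + 1) (a := 1) (b := 0) (by simpa using card_dvd_one_mod_four_le h (2 * j + 1))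
  simp only [pow_one, pow_zero, one_mul] at e
  have hu := isRegular_div_one_sub_pow hζ (by omega) (show 0 < 4 * j + 3 by omega) hd
    (show 0 < 2 * h + 1 by omega)
  have h1 := (hasVal_one.sub (hasVal_q (ζ := ζ))).inv (sub_ne_zero.2 (hζ.ne_one (by omega)).symm)
  have hζ0 : ζ ≠ 0 := hζ.ne_zero (by omega)
  have h2 := ((hasVal_q (ζ := ζ)).pow (2 * j + 1)).inv (pow_ne_zero _ hζ0)
  have := (hasVal_qInt_zero hζ (by omega) hd).zero_mul_isRegular
    (((hu.mul h1.isRegular).mul h2.isRegular).mul hg)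
  convert this using 1
  rw [oddValue, ← e, sq, qInt]
  have := one_sub_q_pow_ne (i := 2 * h + 1) (by omega)
  field_simp

end CaseThree

/-! ### From local vanishing to the congruence. -/

section Assembly

theorem lower_order_truncSum {ζ : ℂ} {n h M : ℕ} (hn : n % 2 = 1) (hh : 0 < h)
    (hζ : IsPrimitiveRoot ζ (2 * h + 1)) (hd : 2 * h + 1 ∣ n)
    (hM : M = (n - 1) / 2 ∨ M = n - 1) : HasVal ζ (truncSum M) 0 := by
  obtain ⟨c, rfl⟩ := hd
  rw [truncSum_eq]
  rcases hM with hM | hM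
  · obtain ⟨l, rfl⟩ : ∃ l, c = 2 * l + 1 := by
      have : c % 2 = 1 := by
        rcases Nat.mod_two_eq_zero_or_one c with h0 | h0
        · rw [Nat.mul_mod, h0] at hn
          simp at hn
        · exact h0
      exact ⟨c / 2, by omega⟩
    -- With n = (2h+1)(2l+1), (n-1)/2 = (2h+1)l + h: l full blocks and a half block.
    have : M + 1 = (2 * h + 1) * l + (h + 1) := by
      have e : (2 * h + 1) * (2 * l + 1) = 2 * ((2 * h + 1) * l + h) + 1 := by ring
      rw [e] at hM
      omega
    rw [this]
    exact hasVal_sum_half_blocks hh hζ l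
  · have : M + 1 = (2 * h + 1) * c := by omega
    rw [this]
    exact hasVal_sum_full_blocks hh hζ c

theorem modulus_dvd {n : ℕ} (hn : 1 < n) {p : ℚ[X]} (h1 : cyclotomic n ℚ ^ 5 ∣ p)
    (h2 : ∀ d, d ∣ n → 1 < d → d ≠ n → cyclotomic d ℚ ∣ p) :
    qIntPoly n * cyclotomic n ℚ ^ 4 ∣ p := by
  have hmem : n ∈ n.divisors.erase 1 := by simp; omega
  rw [qIntPoly, ← prod_cyclotomic_eq_geom_sum (by omega), ← Finset.mul_prod_erase _ _ hmem,
    mul_right_comm, ← pow_succ']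
  refine IsCoprime.mul_dvd (IsCoprime.prod_right fun d hd => ?_) h1
    (Finset.prod_dvd_of_coprime (fun d hd d' hd' hne => cyclotomic.isCoprime_rat hne)
      fun d hd => ?_)
  · exact IsCoprime.pow_left (cyclotomic.isCoprime_rat (Finset.ne_of_mem_erase hd).symm)
  · have h3 := Finset.mem_of_mem_erase hd
    have h4 := Nat.dvd_of_mem_divisors (Finset.mem_of_mem_erase h3)
    have h5 := Finset.ne_of_mem_erase h3
    have h6 := Nat.pos_of_dvd_of_pos h4 (by omega)
    exact h2 d h4 (by omega) (Finset.ne_of_mem_erase hd)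

theorem congrMod_of_local {n M : ℕ} (hn : 1 < n) (hodd : n % 2 = 1)
    (hM : M = (n - 1) / 2 ∨ M = n - 1) {R : RatFunc ℚ}
    (htop : ∀ ζ : ℂ, IsPrimitiveRoot ζ n →
      ∃ T, HasVal ζ T 0 ∧ truncSum M - R = (1 - q ^ n) ^ 4 * T)
    (hlow : ∀ (ζ : ℂ) (h : ℕ), 0 < h → IsPrimitiveRoot ζ (2 * h + 1) → 2 * h + 1 ∣ n →
      HasVal ζ R 0) :
    CongrMod (qIntPoly n * cyclotomic n ℚ ^ 4) (truncSum M) R := by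
  refine modulus_dvd hn ?_ ?_
  · have hζ := Complex.isPrimitiveRoot_exp n (by omega)
    obtain ⟨T, hT, e⟩ := htop _ hζ
    exact cyclotomic_pow_dvd_num (by omega) hζ hT e
  · intro d hd hd1 _
    obtain ⟨h, rfl⟩ : ∃ h, d = 2 * h + 1 := by
      obtain ⟨c, rfl⟩ := hd
      rcases Nat.mod_two_eq_zero_or_one d with h0 | h0
      · rw [Nat.mul_mod, h0] at hodd
        simp at hodd
      · exact ⟨d / 2, by omega⟩
    have hζ := Complex.isPrimitiveRoot_exp (2 * h + 1) (by omega)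
    have := (lower_order_truncSum hodd (by omega) hζ hd hM).sub
      (hlow _ h (by omega) hζ hd)
    rw [sub_zero] at this
    simpa using cyclotomic_pow_dvd_num (e := 0) (by omega) hζ this (by simp)

end Assembly

end QSuper

theorem theorem1p1 (n : ℕ) (hn : 0 < n) (M : ℕ) (hM : M = (n - 1) / 2 ∨ M = n - 1) :
    (n % 4 = 1 →
      QSuper.CongrMod (QSuper.qIntPoly n * Polynomial.cyclotomic n ℚ ^ 4)
        (QSuper.truncSum M)
        (QSuper.qInt n
          * (QSuper.qPoch (QSuper.q ^ 2) (QSuper.q ^ 4) ((n - 1) / 4) ^ 2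
            / QSuper.qPoch (QSuper.q ^ 4) (QSuper.q ^ 4) ((n - 1) / 4) ^ 2)
          * (1 + QSuper.qInt n ^ 2
            * ∑ j ∈ Finset.Icc 1 ((n - 1) / 2),
                (-1) ^ (j + 1) * QSuper.q ^ (2 * (j : ℤ) - (n : ℤ)) / QSuper.qInt (2 * j) ^ 2)))
    ∧ (n % 4 = 3 →
      QSuper.CongrMod (QSuper.qIntPoly n * Polynomial.cyclotomic n ℚ ^ 4)
        (QSuper.truncSum M)
        (QSuper.qInt n ^ 2 * QSuper.q ^ ((1 - (n : ℤ)) / 2)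
          * (QSuper.qPoch (QSuper.q ^ 3) (QSuper.q ^ 4) ((n - 1) / 2)
            / QSuper.qPoch (QSuper.q ^ 5) (QSuper.q ^ 4) ((n - 1) / 2)))) := by
  refine ⟨fun h4 => ?_, fun h4 => ?_⟩
  · obtain ⟨j, rfl⟩ : ∃ j, n = 4 * j + 1 := ⟨n / 4, by omega⟩
    rw [show (4 * j + 1 - 1) / 4 = j by omega, show (4 * j + 1 - 1) / 2 = 2 * j by omega,
      QSuper.correction_sum_eq, ← QSuper.oddEvenRatio_sq_eq, ← sub_eq_add_neg]
    -- For n = 1 the root would be ζ = 1, where the local argument fails; there both sides coincide.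
    rcases Nat.eq_zero_or_pos j with rfl | hj
    · obtain rfl : M = 0 := by omega
      have h1 := QSuper.one_sub_q_ne
      have : QSuper.truncSum 0 - QSuper.qInt (4 * 0 + 1) * QSuper.oddEvenRatio (QSuper.q ^ 2) 0 ^ 2
          * (1 - (1 - QSuper.q ^ (4 * 0 + 1)) ^ 2 / QSuper.q ^ (4 * 0 + 1)
            * QSuper.logDerivSum (QSuper.q ^ 2) 0) = 0 := by
        simp [QSuper.truncSum, QSuper.qInt, QSuper.oddEvenRatio, QSuper.logDerivSum,
          QSuper.qPoch, h1]
      rw [QSuper.CongrMod, this, RatFunc.num_zero]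
      exact dvd_zero _
    · exact QSuper.congrMod_of_local (R := QSuper.evenValue j) (by omega) (by omega) hM
        (fun ζ hζ => QSuper.top_order_even hj hζ (by omega))
        (fun ζ h hh hζ hd => QSuper.lower_order_even hh hζ hd)
  · obtain ⟨j, rfl⟩ : ∃ j, n = 4 * j + 3 := ⟨n / 4, by omega⟩
    have hR : QSuper.qInt (4 * j + 3) ^ 2 * QSuper.q ^ ((1 - ((4 * j + 3 : ℕ) : ℤ)) / 2)
          * (QSuper.qPoch (QSuper.q ^ 3) (QSuper.q ^ 4) ((4 * j + 3 - 1) / 2)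
            / QSuper.qPoch (QSuper.q ^ 5) (QSuper.q ^ 4) ((4 * j + 3 - 1) / 2))
        = QSuper.oddValue j := by
      rw [show (4 * j + 3 - 1) / 2 = 2 * j + 1 by omega,
        show (1 - ((4 * j + 3 : ℕ) : ℤ)) / 2 = -((2 * j + 1 : ℕ) : ℤ) by omega, zpow_neg,
        zpow_natCast, QSuper.oddValue, QSuper.qPoch, QSuper.qPoch, Finset.prod_div_distrib]
      congr 2 <;> exact Finset.prod_congr rfl fun i _ => by ring
    rw [hR]
    exact QSuper.congrMod_of_local (by omega) (by omega) hM
      (fun ζ hζ => QSuper.top_order_odd hζ (by omega))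
      (fun ζ h hh hζ hd => QSuper.lower_order_odd hh hζ hd)
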